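/- Let $G$ be a simply connected $5$-dimensional nilpotent, non-abelian real Lie group with Lie algebra $\mathfrak g$, and let $\Gamma\subset G$ be a discrete subgroup with $\Gamma\backslash G$ compact. Let $\mathrm{Cl}_5$ be the real Clifford algebra of $\mathbb R^5$ with $v^2=-\|v\|^2$, and $W$ an irreducible $\mathrm{Cl}_5$-module; put $j_1=e_1e_2e_3e_4e_5$ acting on $W$. For a left-invariant metric $g$ and a left-invariant orthonormal frame $(e_i)$, spinors on $\Gamma\backslash G$ (for the spin structure given by a homomorphism $\varepsilon:\Gamma\to\{\pm1\}$) are the smooth maps $\varphi:G\to W$ with $\varphi(\gamma x)=\varepsilon(\gamma)\varphi(x)$; the Dirac operator is $D\varphi=\sum_i e_i\nabla_{e_i}\varphi$, where $\nabla_X\varphi=d_X\varphi+\frac12\sum_{j<k}g(\nabla_Xe_j,e_k)e_je_k\varphi$ for left-invariant $X$, with the Levi-Civita connection of $g$ inside the sum. A spinor is left-invariant if $\varphi(yx)=\varphi(x)$ for all $x,y\in G$, and harmonic if $D\varphi=0$. We say that $g$ admits harmonic spinors if there is a non-zero left-invariant harmonic spinor on $\Gamma\backslash G$. A frame is nilpotent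 if $[e_i,e_j]\in\langle e_k: k>\max(i,j)\rangle$ for all $i,j$. Lie algebras are denoted by listing $(de^1,\dots,de^5)$ for a dual basis, with $d\alpha(X,Y)=-\alpha([X,Y])$ for $\alpha\in\mathfrak g^*$; put $$L_3\oplus A_2=(0,0,0,0,12),\quad L_4\oplus A_1=(0,0,0,12,14),\quad \mathcal N_{5,6}=(0,0,0,0,12+34),\quad \mathcal N_{5,5}=(0,0,0,12,13),$$ $$\mathcal N_{5,4}=(0,0,0,12,14+23),\quad \mathcal N_{5,3}=(0,0,12,13,23),\quad \mathcal N_{5,2}=(0,0,12,13,14),\quad \mathcal N_{5,1}=(0,0,12,13,14+23).$$ 1. If some left-invariant metric $g$ admits harmonic spinors, then $\mathfrak g$ is isomorphic to one of $\mathcal N_{5,6},\mathcal N_{5,5},\mathcal N_{5,4},\mathcal N_{5,2},\mathcal N_{5,1}$. 2. If $\mathfrak g$ is isomorphic to $L_3\oplus A_2$, $L_4\oplus A_1$ or $\mathcal N_{5,3}$, then no left-invariant metric admits harmonic spinors. 3. If $\mathfrak g$ is isomorphic to one of the five algebras in 1, then some left-invariant metric admits harmonic spinors. 4. For every left-invariant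 metric there is an orthonormal nilpotent basis $e$ in one of the eight normal forms of the table below, in which $de^1=de^2=0$, the $\mu$'s are non-zero and the $\lambda$'s arbitrary real numbers. 5. Let $e$ be any orthonormal nilpotent basis and $\mu=\sum_i\|de^i\|^2$. There is a vector $v$ such that $16D^2\varphi=\mu\varphi+v\cdot j_1\varphi$ for all left-invariant spinors $\varphi$ (in the trivialization by $e$), and the metric admits harmonic spinors if and only if $\mu=\|v\|$. 6. For each normal form, the formula in 5 holds with the vector $v$ listed, and the metric admits harmonic spinors if and only if the condition in the last column holds: | algebra | $de^3$ | $de^4$ | $de^5$ | $v$ | condition | |---|---|---|---|---|---| | $L_3\oplus A_2$ | $0$ | $0$ | $\mu_{12}e^{12}$ | $0$ | never | | $L_4\oplus A_1$ | $0$ | $\mu_{12}e^{12}$ | $e^1\wedge(\lambda_{12}e^2+\lambda_{13}e^3+\mu_{14}e^4)$ | $-2\mu_{12}\lambda_{13}e_1$ | never | | $\mathcal N_{5,6}$ | $0$ | $0$ | $\mu_{12}e^{12}+\mu_{34}e^{34}$ | $2\mu_{12}\mu_{34}e_5$ | $\mu_{12}=\pm\mu_{34}$ | | $\mathcal N_{5,5}$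 | $0$ | $\mu_{12}e^{12}$ | $\mu_{13}e^{13}$ | $-2\mu_{12}\mu_{13}e_1$ | $\mu_{12}=\pm\mu_{13}$ | | $\mathcal N_{5,4}$ | $0$ | $\mu_{12}e^{12}$ | $e^1\wedge(\lambda_{12}e^2+\lambda_{13}e^3+\mu_{14}e^4)+\mu_{23}e^{23}$ | $2(-\mu_{12}\lambda_{13}e_1-\mu_{12}\mu_{23}e_2+\mu_{14}\mu_{23}e_5)$ | $\lambda_{12}=\lambda_{13}=0$ and $\mu_{14}^2=\mu_{23}^2-\mu_{12}^2$ | | $\mathcal N_{5,3}$ | $\mu_{12}e^{12}$ | $e^1\wedge(\lambda_4e^2+\mu_{13}e^3)$ | $\lambda_5e^{12}+\mu_{23}e^{23}$ | $2(\mu_{13}\lambda_5e_1-\lambda_4\mu_{23}e_2-\mu_{13}\mu_{23}e_3)$ | never | | $\mathcal N_{5,2}$ | $\mu_{12}e^{12}$ | $e^1\wedge(\lambda_4e^2+\mu_{13}e^3)$ | $e^1\wedge(\lambda_5e^2+\lambda_{13}e^3+\mu_{14}e^4)$ | $2(\mu_{12}\mu_{14}-\lambda_4\lambda_{13}+\mu_{13}\lambda_5)e_1$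 | $\mu_{12}=\pm\mu_{14}$, $\lambda_4=\mp\lambda_{13}$, $\mu_{13}=\pm\lambda_5$ (all upper or all lower signs) | | $\mathcal N_{5,1}$ | $\mu_{12}e^{12}$ | $e^1\wedge(\lambda_4e^2+\mu_{13}e^3)$ | $e^1\wedge(\lambda_5e^2+\lambda_{13}e^3+\mu_{14}e^4)+\mu_{23}e^{23}$ | $2((\mu_{12}\mu_{14}-\lambda_4\lambda_{13}+\mu_{13}\lambda_5)e_1-\mu_{23}(\lambda_4e_2+\mu_{13}e_3)+\mu_{14}\mu_{23}e_5)$ | $(\mu_{12}^2+\lambda_4^2+\mu_{13}^2+\lambda_5^2+\lambda_{13}^2+\mu_{14}^2+\mu_{23}^2)^2=4\big(\mu_{14}^2\mu_{23}^2+(-\mu_{13}\lambda_5+\lambda_{13}\lambda_4-\mu_{12}\mu_{14})^2+\lambda_4^2\mu_{23}^2+\mu_{13}^2\mu_{23}^2\big)$ | All statements about the (non-)existence of harmonic spinors hold for every orthonormal left-invariant frame used to trivialize the spinor bundle. -/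

import Mathlib

open scoped Manifold ContDiff

noncomputable section

namespace NilSpin

/-! ### Metric Lie algebras, the Levi-Civita connection, structure equations -/

section MetricLieAlgebra

variable {𝔤 : Type*} [LieRing 𝔤] [LieAlgebra ℝ 𝔤]

/-- A left-invariant Riemannian metric on a Lie group with Lie algebra `𝔤`, given by its value at
the identity: a positive definite inner product on `𝔤`, which is transported to the other tangent
spaces by left translations. -/
structure LeftInvariantMetric (𝔤 : Type*) [LieRing 𝔤] [LieAlgebra ℝ 𝔤] where
  /-- the inner product on `𝔤` -/
  inner : LinearMap.BilinForm ℝ 𝔤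
  symm : ∀ X Y, inner X Y = inner Y X
  pos : ∀ X, X ≠ 0 → 0 < inner X X

/-- The basis `e` of `𝔤` (a left-invariant frame of the group) is orthonormal. -/
def LeftInvariantMetric.IsOrthonormal (g : LeftInvariantMetric 𝔤)
    (e : Module.Basis (Fin 5) ℝ 𝔤) : Prop :=
  ∀ i j, g.inner (e i) (e j) = if i = j then 1 else 0

theorem LeftInvariantMetric.nondegenerate (g : LeftInvariantMetric 𝔤) :
    g.inner.Nondegenerate := by
  constructor
  · intro X hX
    by_contra h
    exact absurd (hX X) (g.pos X h).ne'
  · intro X hX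
    by_contra h
    exact absurd (hX X) (g.pos X h).ne'

/-- The linear form `Z ↦ g(∇_X Y, Z)` given by the Koszul formula on left-invariant fields. -/
def LeftInvariantMetric.koszul (g : LeftInvariantMetric 𝔤) (X Y : 𝔤) : Module.Dual ℝ 𝔤 where
  toFun Z := (1 / 2 : ℝ) * (g.inner ⁅X, Y⁆ Z - g.inner ⁅Y, Z⁆ X + g.inner ⁅Z, X⁆ Y)
  map_add' Z Z' := by simp only [lie_add, add_lie, map_add, LinearMap.add_apply]; ring
  map_smul' c Z := by
    simp only [lie_smul, smul_lie, map_smul, LinearMap.smul_apply, smul_eq_mul, RingHom.id_apply]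
    ring

/-- The Levi-Civita connection on left-invariant vector fields. -/
def LeftInvariantMetric.leviCivita [FiniteDimensional ℝ 𝔤] (g : LeftInvariantMetric 𝔤)
    (X Y : 𝔤) : 𝔤 :=
  (g.inner.toDual g.nondegenerate).symm (g.koszul X Y)

theorem LeftInvariantMetric.inner_leviCivita [FiniteDimensional ℝ 𝔤] (g : LeftInvariantMetric 𝔤)
    (X Y Z : 𝔤) : g.inner (g.leviCivita X Y) Z =
      (1 / 2 : ℝ) * (g.inner ⁅X, Y⁆ Z - g.inner ⁅Y, Z⁆ X + g.inner ⁅Z, X⁆ Y) :=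
  LinearMap.BilinForm.apply_toDual_symm_apply _ _

/-- The connection is metric. -/
theorem LeftInvariantMetric.leviCivita_metric [FiniteDimensional ℝ 𝔤]
    (g : LeftInvariantMetric 𝔤) (X Y Z : 𝔤) :
    g.inner (g.leviCivita X Y) Z + g.inner Y (g.leviCivita X Z) = 0 := by
  rw [g.symm Y, g.inner_leviCivita, g.inner_leviCivita, ← lie_skew X Y, ← lie_skew X Z,
    ← lie_skew Y Z]
  simp only [map_neg, LinearMap.neg_apply]
  ring

/-- The connection is torsion-free. -/
theorem LeftInvariantMetric.leviCivita_torsion [FiniteDimensional ℝ 𝔤]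
    (g : LeftInvariantMetric 𝔤) (X Y : 𝔤) :
    g.leviCivita X Y - g.leviCivita Y X = ⁅X, Y⁆ := by
  have h : ∀ Z, g.inner (g.leviCivita X Y - g.leviCivita Y X - ⁅X, Y⁆) Z = 0 := by
    intro Z
    simp only [map_sub, LinearMap.sub_apply]
    rw [g.inner_leviCivita, g.inner_leviCivita, ← lie_skew X Y, ← lie_skew X Z, ← lie_skew Y Z]
    simp only [map_neg, LinearMap.neg_apply]
    ring
  by_contra hne
  exact absurd (h _) (g.pos _ (sub_ne_zero.mpr hne)).ne'

/-- The frame is nilpotent: `[e_i, e_j] = ∑_{k > i, j} c_{ij}^k e_k`. -/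
def IsNilpotentFrame (e : Module.Basis (Fin 5) ℝ 𝔤) : Prop :=
  ∀ i j k, k ≤ i ∨ k ≤ j → e.repr ⁅e i, e j⁆ k = 0

/-- The Chevalley-Eilenberg differential `de^k` of the `k`-th element of the dual basis, as the
matrix of values `de^k(e_i, e_j) = -e^k([e_i, e_j])`. -/
def coframeDiff (e : Module.Basis (Fin 5) ℝ 𝔤) (k : Fin 5) : Matrix (Fin 5) (Fin 5) ℝ :=
  Matrix.of fun i j => -(e.repr ⁅e i, e j⁆ k)

/-- The 2-form `e^i ∧ e^j`, as the matrix of its values on the basis. The indices `1, …, 5` of the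
usual notation are `0, …, 4` here: `e^{12}` is `wedge 0 1`. -/
def wedge (i j : Fin 5) : Matrix (Fin 5) (Fin 5) ℝ :=
  Matrix.single i j 1 - Matrix.single j i 1

/-- The structure equations `de^1 = 0, de^2 = 0, de^3 = a, de^4 = b, de^5 = c`. -/
def StructureEqs (e : Module.Basis (Fin 5) ℝ 𝔤) (a b c : Matrix (Fin 5) (Fin 5) ℝ) : Prop :=
  coframeDiff e 0 = 0 ∧ coframeDiff e 1 = 0 ∧ coframeDiff e 2 = a ∧ coframeDiff e 3 = b ∧
    coframeDiff e 4 = c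

/-- `μ = ∑_k ‖de^k‖²`, where `‖∑_{i<j} a_{ij} e^{ij}‖² = ∑_{i<j} a_{ij}²`. -/
def muConst (e : Module.Basis (Fin 5) ℝ 𝔤) : ℝ :=
  ∑ k, ∑ i, ∑ j ∈ Finset.Ioi i, (coframeDiff e k i j) ^ 2

/-! The eight non-abelian nilpotent Lie algebras of dimension 5, in the notation that lists
`de^1, …, de^5` for a suitable basis. -/

variable (𝔤)

/-- `L_3 ⊕ A_2 = (0,0,0,0,12)` -/
def IsL3A2 : Prop := ∃ e : Module.Basis (Fin 5) ℝ 𝔤, StructureEqs e 0 0 (wedge 0 1)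

/-- `L_4 ⊕ A_1 = (0,0,0,12,14)` -/
def IsL4A1 : Prop := ∃ e : Module.Basis (Fin 5) ℝ 𝔤, StructureEqs e 0 (wedge 0 1) (wedge 0 3)

/-- `N_{5,6} = (0,0,0,0,12+34)` -/
def IsN56 : Prop := ∃ e : Module.Basis (Fin 5) ℝ 𝔤, StructureEqs e 0 0 (wedge 0 1 + wedge 2 3)

/-- `N_{5,5} = (0,0,0,12,13)` -/
def IsN55 : Prop := ∃ e : Module.Basis (Fin 5) ℝ 𝔤, StructureEqs e 0 (wedge 0 1) (wedge 0 2)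

/-- `N_{5,4} = (0,0,0,12,14+23)` -/
def IsN54 : Prop := ∃ e : Module.Basis (Fin 5) ℝ 𝔤,
  StructureEqs e 0 (wedge 0 1) (wedge 0 3 + wedge 1 2)

/-- `N_{5,3} = (0,0,12,13,23)` -/
def IsN53 : Prop := ∃ e : Module.Basis (Fin 5) ℝ 𝔤,
  StructureEqs e (wedge 0 1) (wedge 0 2) (wedge 1 2)

/-- `N_{5,2} = (0,0,12,13,14)` -/
def IsN52 : Prop := ∃ e : Module.Basis (Fin 5) ℝ 𝔤,
  StructureEqs e (wedge 0 1) (wedge 0 2) (wedge 0 3)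

/-- `N_{5,1} = (0,0,12,13,14+23)` -/
def IsN51 : Prop := ∃ e : Module.Basis (Fin 5) ℝ 𝔤,
  StructureEqs e (wedge 0 1) (wedge 0 2) (wedge 0 3 + wedge 1 2)

variable {𝔤}

/-! Normal forms of the eight metric Lie algebras in an orthonormal nilpotent basis; the `μ` are
non-zero, the `l` are arbitrary. -/

/-- Normal form of a metric on `L_3 ⊕ A_2`. -/
def FormL3A2 (e : Module.Basis (Fin 5) ℝ 𝔤) (μ₁₂ : ℝ) : Prop :=
  μ₁₂ ≠ 0 ∧ StructureEqs e 0 0 (μ₁₂ • wedge 0 1)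

/-- Normal form of a metric on `L_4 ⊕ A_1`. -/
def FormL4A1 (e : Module.Basis (Fin 5) ℝ 𝔤) (μ₁₂ l₁₂ l₁₃ μ₁₄ : ℝ) : Prop :=
  μ₁₂ ≠ 0 ∧ μ₁₄ ≠ 0 ∧ StructureEqs e 0 (μ₁₂ • wedge 0 1)
    (l₁₂ • wedge 0 1 + l₁₃ • wedge 0 2 + μ₁₄ • wedge 0 3)

/-- Normal form of a metric on `N_{5,6}`. -/
def FormN56 (e : Module.Basis (Fin 5) ℝ 𝔤) (μ₁₂ μ₃₄ : ℝ) : Prop :=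
  μ₁₂ ≠ 0 ∧ μ₃₄ ≠ 0 ∧ StructureEqs e 0 0 (μ₁₂ • wedge 0 1 + μ₃₄ • wedge 2 3)

/-- Normal form of a metric on `N_{5,5}`. -/
def FormN55 (e : Module.Basis (Fin 5) ℝ 𝔤) (μ₁₂ μ₁₃ : ℝ) : Prop :=
  μ₁₂ ≠ 0 ∧ μ₁₃ ≠ 0 ∧ StructureEqs e 0 (μ₁₂ • wedge 0 1) (μ₁₃ • wedge 0 2)

/-- Normal form of a metric on `N_{5,4}`. -/
def FormN54 (e : Module.Basis (Fin 5) ℝ 𝔤) (μ₁₂ l₁₂ l₁₃ μ₁₄ μ₂₃ : ℝ) : Prop :=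
  μ₁₂ ≠ 0 ∧ μ₁₄ ≠ 0 ∧ μ₂₃ ≠ 0 ∧ StructureEqs e 0 (μ₁₂ • wedge 0 1)
    (l₁₂ • wedge 0 1 + l₁₃ • wedge 0 2 + μ₁₄ • wedge 0 3 + μ₂₃ • wedge 1 2)

/-- Normal form of a metric on `N_{5,3}`; `l₄` and `l₅` are the coefficients of `e^{12}` in `de^4`
and `de^5`. -/
def FormN53 (e : Module.Basis (Fin 5) ℝ 𝔤) (μ₁₂ l₄ μ₁₃ l₅ μ₂₃ : ℝ) : Prop :=
  μ₁₂ ≠ 0 ∧ μ₁₃ ≠ 0 ∧ μ₂₃ ≠ 0 ∧ StructureEqs e (μ₁₂ • wedge 0 1)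
    (l₄ • wedge 0 1 + μ₁₃ • wedge 0 2) (l₅ • wedge 0 1 + μ₂₃ • wedge 1 2)

/-- Normal form of a metric on `N_{5,2}`. -/
def FormN52 (e : Module.Basis (Fin 5) ℝ 𝔤) (μ₁₂ l₄ μ₁₃ l₅ l₁₃ μ₁₄ : ℝ) : Prop :=
  μ₁₂ ≠ 0 ∧ μ₁₃ ≠ 0 ∧ μ₁₄ ≠ 0 ∧ StructureEqs e (μ₁₂ • wedge 0 1)
    (l₄ • wedge 0 1 + μ₁₃ • wedge 0 2) (l₅ • wedge 0 1 + l₁₃ • wedge 0 2 + μ₁₄ • wedge 0 3)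

/-- Normal form of a metric on `N_{5,1}`. -/
def FormN51 (e : Module.Basis (Fin 5) ℝ 𝔤) (μ₁₂ l₄ μ₁₃ l₅ l₁₃ μ₁₄ μ₂₃ : ℝ) : Prop :=
  μ₁₂ ≠ 0 ∧ μ₁₃ ≠ 0 ∧ μ₁₄ ≠ 0 ∧ μ₂₃ ≠ 0 ∧ StructureEqs e (μ₁₂ • wedge 0 1)
    (l₄ • wedge 0 1 + μ₁₃ • wedge 0 2)
    (l₅ • wedge 0 1 + l₁₃ • wedge 0 2 + μ₁₄ • wedge 0 3 + μ₂₃ • wedge 1 2)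

end MetricLieAlgebra

/-! ### The Clifford algebra -/

/-- The real Clifford algebra of Euclidean `ℝ⁵`, with the convention `v² = -‖v‖²`. -/
abbrev Cl5 : Type :=
  CliffordAlgebra (QuadraticMap.weightedSumSquares ℝ (fun _ : Fin 5 => (-1 : ℝ)))

/-- A vector of `ℝ⁵` as an element of the Clifford algebra. -/
def clVec (v : Fin 5 → ℝ) : Cl5 :=
  CliffordAlgebra.ι (QuadraticMap.weightedSumSquares ℝ (fun _ : Fin 5 => (-1 : ℝ))) v

/-- The generator `e_i` of the Clifford algebra. -/
def clGen (i : Fin 5) : Cl5 := clVec (Pi.single i 1)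

/-- The volume element `e_1 e_2 e_3 e_4 e_5`; it acts on spinors as the complex structure `j_1`. -/
def clVol : Cl5 := clGen 0 * clGen 1 * clGen 2 * clGen 3 * clGen 4

/-! ### Spinors and the Dirac operator on a quotient `Γ \ G` -/

instance : ENat.LEInfty (minSmoothness ℝ 3) := by
  rw [minSmoothness_of_isRCLikeNormedField]
  infer_instance

section Group

variable {G : Type*} [TopologicalSpace G] [ChartedSpace (EuclideanSpace ℝ (Fin 5)) G] [Group G]

instance : FiniteDimensional ℝ (GroupLieAlgebra (𝓡 5) G) :=
  inferInstanceAs (FiniteDimensional ℝ (EuclideanSpace ℝ (Fin 5)))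

variable {W : Type*} [NormedAddCommGroup W] [NormedSpace ℝ W] [Module Cl5 W]

/-- Spinors on `Γ \ G` for the spin structure `ε : Γ → {±1}`: trivialize the spinor bundle of `G` by
a left-invariant orthonormal frame; then sections over `Γ \ G` are the smooth maps `φ : G → W` with
`φ(γx) = ε(γ)φ(x)`. -/
def IsSpinor (Γ : Subgroup G) (ε : Γ →* ℤˣ) (φ : G → W) : Prop :=
  ContMDiff (𝓡 5) 𝓘(ℝ, W) ∞ φ ∧ ∀ (γ : Γ) (x : G), φ (γ * x) = ((ε γ : ℤˣ) : ℤ) • φ x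

/-- Left-invariant spinors: those invariant under all left translations of `G`. -/
def IsLeftInvariantSpinor (φ : G → W) : Prop := ∀ y x : G, φ (y * x) = φ x

variable [LieGroup (𝓡 5) ∞ G]

/-- The spinor connection in the trivialization by the left-invariant orthonormal frame `e`:
`∇_X φ = dφ(X) + ½ ∑_{j<k} g(∇_X e_j, e_k) e_j e_k φ`, for `X` a left-invariant field. -/
def spinConnection (g : LeftInvariantMetric (GroupLieAlgebra (𝓡 5) G))
    (e : Module.Basis (Fin 5) ℝ (GroupLieAlgebra (𝓡 5) G))
    (X : GroupLieAlgebra (𝓡 5) G) (φ : G → W) (x : G) : W :=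
  (show W from mfderiv (𝓡 5) 𝓘(ℝ, W) φ x (mulInvariantVectorField X x)) +
    (1 / 2 : ℝ) • ∑ j, ∑ k ∈ Finset.Ioi j,
      g.inner (g.leviCivita X (e j)) (e k) • (clGen j * clGen k) • φ x

/-- The Dirac operator `Dφ = ∑_i e_i ∇_{e_i} φ`. -/
def dirac (g : LeftInvariantMetric (GroupLieAlgebra (𝓡 5) G))
    (e : Module.Basis (Fin 5) ℝ (GroupLieAlgebra (𝓡 5) G)) (φ : G → W) (x : G) : W :=
  ∑ i, clGen i • spinConnection g e (e i) φ x

variable (W) in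
/-- `Γ \ G` with the metric `g` carries a non-zero left-invariant harmonic spinor (the spinor bundle
being trivialized by the orthonormal frame `f`). -/
def HasHarmonicSpinor (Γ : Subgroup G) (g : LeftInvariantMetric (GroupLieAlgebra (𝓡 5) G))
    (f : Module.Basis (Fin 5) ℝ (GroupLieAlgebra (𝓡 5) G)) : Prop :=
  ∃ (ε : Γ →* ℤˣ) (φ : G → W), IsSpinor Γ ε φ ∧ IsLeftInvariantSpinor φ ∧ φ ≠ 0 ∧
    ∀ x, dirac g f φ x = 0

variable (W) in
/-- `16 D²φ = μφ + v · j_1 φ` on left-invariant spinors, where `v = ∑ v_i e_i` and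
`μ = ∑_k ‖de^k‖²`. -/
def DiracSquareFormula (g : LeftInvariantMetric (GroupLieAlgebra (𝓡 5) G))
    (e : Module.Basis (Fin 5) ℝ (GroupLieAlgebra (𝓡 5) G)) (v : Fin 5 → ℝ) : Prop :=
  ∀ φ : G → W, IsLeftInvariantSpinor φ → ∀ x,
    (16 : ℝ) • dirac g e (dirac g e φ) x = muConst e • φ x + clVec v • clVol • φ x

end Group

end NilSpin

end

noncomputable section

namespace NilSpin

/-! ### Cubic elements of the Clifford algebra -/

/-! Left-invariant spinors are constant maps, so `D` acts on them by a fixed element of the Clifford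
algebra. The Koszul formula makes it `¼ ∑ T_{ijk} e_i e_j e_k` plus a vector whose coefficients are
the traces of `ad e_i`; nilpotency kills the vector (`sum_spin_eq_cubic`, `dirac_const`). Here
`T(X,Y,Z) = g([X,Y],Z) + g([Y,Z],X) + g([Z,X],Y)`.

In dimension five, the square of a cubic element is a scalar `|T|²` plus `v j_1` with `v` quadratic
in `T` (`cubic_mul_cubic`). Since `j_1` is central with square `-1`, the operator `v j_1` squares to
`‖v‖²`, and `D` has a kernel exactly when `|T|⁴ = ‖v‖²` (`exists_cubic_smul_eq_zero_iff`). In a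
nilpotent frame the `T_{ijk}` with `i < j < k` are the structure constants, so `|T|² = μ`. The
criterion holds in every orthonormal frame because `|T|²` and `‖v‖²` are combinations of invariants
of the contraction of `T` with itself (`IsAlternating.sum_sum_sq`).

The rest is algebra. A frame adapted to a central flag leaves ten structure constants, and explicit
basis changes reduce them to eight models (`isListed_of_finrank_eq`). Gram-Schmidt along the flag of
a model keeps its pattern of zeros up to triangular corrections (`HasBrackets.exists_adapted`); this
is already the normal form, except that `N_{5,5}` and `N_{5,3}` need a singular value decomposition
and `N_{5,6}` the normal form of a skew matrix. In each normal form other than that of `N_{5,1}`,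
`μ² - ‖v‖²` is a sum of non-negative terms or a product of two such sums, which gives the simplified
condition. Existence follows by declaring a suitable basis orthonormal. -/

theorem clGen_sq (i : Fin 5) : clGen i * clGen i = -1 := by
  rw [clGen, clVec, CliffordAlgebra.ι_sq_scalar]
  have h : QuadraticMap.weightedSumSquares ℝ (fun _ : Fin 5 => (-1 : ℝ)) (Pi.single i 1) = -1 := by
    rw [QuadraticMap.weightedSumSquares_apply, Finset.sum_eq_single i] <;>
      simp +contextual
  rw [h, map_neg, map_one]

theorem clGen_mul_swap {i j : Fin 5} (h : i < j) : clGen j * clGen i = -(clGen i * clGen j) := by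
  replace h := h.ne
  rw [eq_neg_iff_add_eq_zero, clGen, clGen, clVec, clVec, CliffordAlgebra.ι_mul_ι_add_swap]
  have : QuadraticMap.polar (QuadraticMap.weightedSumSquares ℝ (fun _ : Fin 5 => (-1 : ℝ)))
      (Pi.single j 1) (Pi.single i 1) = 0 := by
    simp only [QuadraticMap.polar, QuadraticMap.weightedSumSquares_apply, ← Finset.sum_sub_distrib]
    refine Finset.sum_eq_zero fun k _ => ?_
    by_cases hk : k = i
    · subst hk; simp [h]
    · simp [hk, Pi.single_apply]
  rw [this, map_zero]

theorem clVec_eq_sum (v : Fin 5 → ℝ) : clVec v = ∑ i, v i • clGen i := by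
  conv_lhs => rw [← Finset.univ_sum_single v]
  simp only [clGen, clVec, map_sum, ← map_smul]
  refine Finset.sum_congr rfl fun i _ => ?_
  congr 1
  rw [← Pi.single_smul, smul_eq_mul, mul_one]

theorem clGen_mul_swap_assoc {i j : Fin 5} (h : i < j) (x : Cl5) :
    clGen j * (clGen i * x) = -(clGen i * (clGen j * x)) := by
  rw [← mul_assoc, clGen_mul_swap h, neg_mul, mul_assoc]

theorem clGen_sq_assoc (i : Fin 5) (x : Cl5) : clGen i * (clGen i * x) = -x := by
  rw [← mul_assoc, clGen_sq, neg_one_mul]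

/-- The element `∑_{i<j<k} T_{ijk} e_i e_j e_k`. -/
def cubic (T : Fin 5 → Fin 5 → Fin 5 → ℝ) : Cl5 :=
  T 0 1 2 • (clGen 0 * clGen 1 * clGen 2) + T 0 1 3 • (clGen 0 * clGen 1 * clGen 3) +
  T 0 1 4 • (clGen 0 * clGen 1 * clGen 4) + T 0 2 3 • (clGen 0 * clGen 2 * clGen 3) +
  T 0 2 4 • (clGen 0 * clGen 2 * clGen 4) + T 0 3 4 • (clGen 0 * clGen 3 * clGen 4) +
  T 1 2 3 • (clGen 1 * clGen 2 * clGen 3) + T 1 2 4 • (clGen 1 * clGen 2 * clGen 4) +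
  T 1 3 4 • (clGen 1 * clGen 3 * clGen 4) + T 2 3 4 • (clGen 2 * clGen 3 * clGen 4)

/-- The scalar part of the square of a cubic element. -/
def cubicNorm (T : Fin 5 → Fin 5 → Fin 5 → ℝ) : ℝ :=
  T 0 1 2 ^ 2 + T 0 1 3 ^ 2 + T 0 1 4 ^ 2 + T 0 2 3 ^ 2 + T 0 2 4 ^ 2 + T 0 3 4 ^ 2 +
    T 1 2 3 ^ 2 + T 1 2 4 ^ 2 + T 1 3 4 ^ 2 + T 2 3 4 ^ 2

/-- The vector `v` for which `v j_1` is the quartic part of the square of a cubic element. -/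
def cubicVec (T : Fin 5 → Fin 5 → Fin 5 → ℝ) : Fin 5 → ℝ :=
  ![2 * (T 0 1 2 * T 0 3 4 - T 0 1 3 * T 0 2 4 + T 0 1 4 * T 0 2 3),
    2 * (T 0 1 2 * T 1 3 4 - T 0 1 3 * T 1 2 4 + T 0 1 4 * T 1 2 3),
    2 * (T 0 1 2 * T 2 3 4 - T 0 2 3 * T 1 2 4 + T 0 2 4 * T 1 2 3),
    2 * (T 0 1 3 * T 2 3 4 - T 0 2 3 * T 1 3 4 + T 0 3 4 * T 1 2 3),
    2 * (T 0 1 4 * T 2 3 4 - T 0 2 4 * T 1 3 4 + T 0 3 4 * T 1 2 4)]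

-- Each `e_i e_j e_k` with distinct indices squares to `+1`. Two different triples from five indices
-- share one or two elements: with two in common the monomials anticommute and cancel, with one in
-- common they commute, and the doubled product is `±e_l j_1` with `l` the common index.
set_option maxHeartbeats 4000000 in
theorem cubic_mul_cubic (T : Fin 5 → Fin 5 → Fin 5 → ℝ) :
    cubic T * cubic T = cubicNorm T • (1 : Cl5) + clVec (cubicVec T) * clVol := by
  simp (disch := decide) only [clVec_eq_sum, Fin.sum_univ_five, cubic, cubicNorm, cubicVec, clVol,
    mul_add, add_mul, smul_mul_assoc, mul_smul_comm, mul_assoc, clGen_mul_swap,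
    clGen_mul_swap_assoc, clGen_sq, clGen_sq_assoc, mul_neg, neg_neg, mul_one, smul_neg]
  simp only [Matrix.cons_val]
  module

/-- A generator anticommutes with the four other factors of the volume element, an even number, and
commutes with itself; so the volume element is central. -/
theorem clVol_mul_clGen (i : Fin 5) : clVol * clGen i = clGen i * clVol := by
  fin_cases i <;>
  simp (disch := decide) only [clVol, mul_assoc, clGen_mul_swap, clGen_mul_swap_assoc, clGen_sq,
    clGen_sq_assoc, mul_neg, neg_neg, mul_one, Fin.mk_zero, Fin.mk_one, Fin.reduceFinMk]

theorem clVol_mul_clVol : clVol * clVol = -1 := by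
  simp (disch := decide) only [clVol, mul_assoc, clGen_mul_swap, clGen_mul_swap_assoc, clGen_sq,
    clGen_sq_assoc, mul_neg, neg_neg, mul_one]

theorem clVol_mul_clVec (v : Fin 5 → ℝ) : clVol * clVec v = clVec v * clVol := by
  simp only [clVec_eq_sum, Finset.mul_sum, Finset.sum_mul, mul_smul_comm, smul_mul_assoc,
    clVol_mul_clGen]

theorem clVec_mul_clVec (v : Fin 5 → ℝ) : clVec v * clVec v = -((∑ i, v i ^ 2) • (1 : Cl5)) := by
  rw [clVec, CliffordAlgebra.ι_sq_scalar, QuadraticMap.weightedSumSquares_apply,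
    Algebra.algebraMap_eq_smul_one, ← neg_smul, ← Finset.sum_neg_distrib]
  congr 1
  exact Finset.sum_congr rfl fun i _ => by rw [smul_eq_mul]; ring

theorem clVec_mul_clVol_sq (v : Fin 5 → ℝ) :
    clVec v * clVol * (clVec v * clVol) = (∑ i, v i ^ 2) • (1 : Cl5) := by
  rw [mul_assoc, ← mul_assoc clVol, clVol_mul_clVec, mul_assoc, clVol_mul_clVol, ← mul_assoc,
    clVec_mul_clVec]
  simp

theorem clVec_mul_swap (v w : Fin 5 → ℝ) (h : ∑ i, v i * w i = 0) :
    clVec v * clVec w = -(clVec w * clVec v) := by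
  rw [eq_neg_iff_add_eq_zero, clVec, clVec, CliffordAlgebra.ι_mul_ι_add_swap]
  have : QuadraticMap.polar (QuadraticMap.weightedSumSquares ℝ (fun _ : Fin 5 => (-1 : ℝ)))
      v w = -2 * ∑ i, v i * w i := by
    simp only [QuadraticMap.polar, QuadraticMap.weightedSumSquares_apply, ← Finset.sum_sub_distrib,
      Finset.mul_sum]
    refine Finset.sum_congr rfl fun k _ => ?_
    simp only [Pi.add_apply, smul_eq_mul]
    ring
  rw [this, h, mul_zero, map_zero]

/-! ### The kernel of a cubic element on a Clifford module -/

section Kernel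

variable {W : Type*} [AddCommGroup W] [Module ℝ W] [Module Cl5 W] [IsScalarTower ℝ Cl5 W]

theorem cubic_smul_smul (T : Fin 5 → Fin 5 → Fin 5 → ℝ) (w : W) :
    cubic T • cubic T • w = cubicNorm T • w + clVec (cubicVec T) • clVol • w := by
  rw [smul_smul, cubic_mul_cubic, add_smul, smul_assoc, one_smul, mul_smul]

theorem cubicNorm_nonneg (T : Fin 5 → Fin 5 → Fin 5 → ℝ) : 0 ≤ cubicNorm T := by
  unfold cubicNorm; positivity

/-- In dimension greater than one, Clifford multiplication by `v j_1` is not a non-zero scalar. -/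
theorem exists_clVec_smul_ne [Nontrivial W] (v : Fin 5 → ℝ) {c : ℝ} (hc : c ≠ 0) :
    ∃ w : W, (clVec v * clVol) • w ≠ c • w := by
  by_contra! h
  -- A vector `u` orthogonal to `v` anticommutes with `v` and commutes with `j_1`, so it
  -- anticommutes with `v j_1`. If `v j_1` were the scalar `c`, this would give `2c u = 0`, although
  -- `u² = -‖u‖²` makes `u` injective.
  obtain ⟨u, hu, huv⟩ : ∃ u : Fin 5 → ℝ, u ≠ 0 ∧ ∑ i, v i * u i = 0 := by
    by_cases h0 : v 0 = 0
    · exact ⟨Pi.single 0 1, by simp, by simp [Pi.single_apply, h0]⟩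
    · refine ⟨![v 1, -v 0, 0, 0, 0], fun h => h0 ?_, ?_⟩
      · simpa using congrFun h 1
      · simp [Fin.sum_univ_five]; ring
  obtain ⟨w, hw⟩ := exists_ne (0 : W)
  have h1 : clVec u • c • w = -(c • clVec u • w) := by
    rw [← h, ← h, smul_smul, smul_smul, mul_assoc, clVol_mul_clVec, ← mul_assoc, ← mul_assoc,
      clVec_mul_swap v u huv, neg_mul, neg_smul, neg_neg]
  have h2 : clVec u • c • w = c • clVec u • w := smul_comm _ _ _
  have h3 : (2 * c) • clVec u • w = 0 := by
    rw [mul_smul, two_smul]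
    nth_rewrite 1 [← h2]
    rw [h1, neg_add_cancel]
  have h4 : clVec u • w = 0 := (smul_eq_zero.1 h3).resolve_left (by simpa using hc)
  have h5 : (∑ i, u i ^ 2) • w = 0 := by
    have := congrArg (fun x => clVec u • x) h4
    simpa [smul_smul, clVec_mul_clVec, neg_smul, smul_assoc] using this
  rcases smul_eq_zero.1 h5 with h6 | h6
  · refine hu (funext fun i => ?_)
    simpa using (Finset.sum_eq_zero_iff_of_nonneg fun i _ => sq_nonneg (u i)).1 h6 i
  · exact hw h6

/-- A kernel vector satisfies `v j_1 w = -μ w`, and applying `v j_1` again gives `‖v‖² = μ²`.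
Conversely, `(μ + v j_1)(v j_1 - μ) = ‖v‖² - μ² = 0`. If the cubic element were injective, so would
be its square `μ + v j_1`, whence `v j_1 = μ` identically, which is impossible. Dimensions of `W`
play no role. -/
theorem exists_cubic_smul_eq_zero_iff [Nontrivial W] (T : Fin 5 → Fin 5 → Fin 5 → ℝ) :
    (∃ w : W, w ≠ 0 ∧ cubic T • w = 0) ↔ cubicNorm T ^ 2 = ∑ i, cubicVec T i ^ 2 := by
  set μ := cubicNorm T
  set v := cubicVec T
  constructor
  · rintro ⟨w, hw, h⟩
    have h1 : (clVec v * clVol) • w = -(μ • w) := by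
      have := cubic_smul_smul T w
      rw [h, smul_zero] at this
      rw [mul_smul]
      exact (neg_eq_of_add_eq_zero_right this.symm).symm
    have h2 : (∑ i, v i ^ 2) • w = (μ ^ 2) • w := by
      rw [← one_smul Cl5 w, ← smul_assoc, ← clVec_mul_clVol_sq, mul_smul, one_smul, h1, smul_neg,
        smul_comm, h1, smul_neg, neg_neg, smul_smul, sq]
    exact (smul_left_injective ℝ hw h2).symm
  · intro h
    by_contra! hne
    have hinj : ∀ w : W, cubic T • w = 0 → w = 0 := fun w hw => by
      by_contra h0
      exact hne w h0 hw
    have hinj2 : ∀ w : W, μ • w + (clVec v * clVol) • w = 0 → w = 0 := fun w hw =>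
      hinj _ (hinj _ (by rw [cubic_smul_smul, ← mul_smul, hw]))
    have hsc : ∀ w : W, (clVec v * clVol) • w = μ • w := fun w => by
      rw [← sub_eq_zero]
      apply hinj2
      rw [smul_sub, smul_sub, smul_smul (clVec v * clVol), clVec_mul_clVol_sq, smul_assoc, one_smul,
        ← h, smul_comm (clVec v * clVol) μ, smul_smul μ μ, sq]
      abel
    -- For `μ = 0` the injective operator `μ + v j_1` would vanish; for `μ ≠ 0` the operator `v j_1`
    -- would be a non-zero scalar.
    by_cases hμ : μ = 0
    · obtain ⟨w, hw⟩ := exists_ne (0 : W)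
      exact hw (hinj2 w (by rw [hsc, hμ]; simp))
    · obtain ⟨w, hw⟩ := exists_clVec_smul_ne (W := W) v hμ
      exact hw (hsc w)

end Kernel

/-! ### Orthonormal frames and the 3-form `∑ e^i ∧ de^i` -/

section Frames

variable {𝔤 : Type*} [LieRing 𝔤] [LieAlgebra ℝ 𝔤]

namespace LeftInvariantMetric

variable {g : LeftInvariantMetric 𝔤} {e f : Module.Basis (Fin 5) ℝ 𝔤}

theorem IsOrthonormal.repr_eq (he : g.IsOrthonormal e) (X : 𝔤) (k : Fin 5) :
    e.repr X k = g.inner X (e k) := by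
  conv_rhs => rw [← e.sum_repr X]
  simp [he _ _, -Module.Basis.sum_repr]

theorem IsOrthonormal.sum_inner_smul (he : g.IsOrthonormal e) (X : 𝔤) :
    ∑ k, g.inner X (e k) • e k = X := by
  simp only [← he.repr_eq, e.sum_repr]

theorem IsOrthonormal.inner_eq_sum (he : g.IsOrthonormal e) (X Y : 𝔤) :
    g.inner X Y = ∑ k, g.inner X (e k) * g.inner Y (e k) := by
  conv_lhs => rw [← he.sum_inner_smul Y]
  simp [mul_comm]

/-- `∑ α(e_i) β(e_i)` does not depend on the orthonormal basis. -/
theorem IsOrthonormal.sum_mul_eq (he : g.IsOrthonormal e) (hf : g.IsOrthonormal f)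
    (α β : 𝔤 →ₗ[ℝ] ℝ) : ∑ i, α (e i) * β (e i) = ∑ i, α (f i) * β (f i) := by
  have h (i : Fin 5) : α (f i) * β (f i) =
      ∑ a, ∑ b, α (e a) * β (e b) * (g.inner (e a) (f i) * g.inner (e b) (f i)) := by
    conv_lhs => rw [← he.sum_inner_smul (f i)]
    simp only [map_sum, map_smul, smul_eq_mul, Finset.sum_mul_sum]
    refine Finset.sum_congr rfl fun a _ => Finset.sum_congr rfl fun b _ => ?_
    rw [g.symm (f i), g.symm (f i)]
    ring
  simp only [h]
  rw [Finset.sum_comm]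
  refine Finset.sum_congr rfl fun a _ => ?_
  rw [Finset.sum_comm]
  simp only [← Finset.mul_sum, ← hf.inner_eq_sum, he a]
  simp

/-- The 3-form `X, Y, Z ↦ g([X,Y],Z) + g([Y,Z],X) + g([Z,X],Y)`, linear in `Z`. -/
def torsion (g : LeftInvariantMetric 𝔤) (X Y : 𝔤) : 𝔤 →ₗ[ℝ] ℝ where
  toFun Z := g.inner ⁅X, Y⁆ Z + g.inner ⁅Y, Z⁆ X + g.inner ⁅Z, X⁆ Y
  map_add' Z Z' := by simp only [lie_add, add_lie, map_add, LinearMap.add_apply]; ring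
  map_smul' c Z := by
    simp only [lie_smul, smul_lie, map_smul, LinearMap.smul_apply, smul_eq_mul, RingHom.id_apply]
    ring

theorem torsion_apply (g : LeftInvariantMetric 𝔤) (X Y Z : 𝔤) :
    g.torsion X Y Z = g.inner ⁅X, Y⁆ Z + g.inner ⁅Y, Z⁆ X + g.inner ⁅Z, X⁆ Y := rfl

theorem torsion_cyclic (g : LeftInvariantMetric 𝔤) (X Y Z : 𝔤) :
    g.torsion X Y Z = g.torsion Y Z X := by
  simp only [torsion_apply]; ring

theorem torsion_swap (g : LeftInvariantMetric 𝔤) (X Y Z : 𝔤) :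
    g.torsion Y X Z = -g.torsion X Y Z := by
  rw [torsion_apply, torsion_apply, ← lie_skew Y X, ← lie_skew X Z, ← lie_skew Z Y]
  simp only [map_neg, LinearMap.neg_apply]
  ring

/-- The components of the torsion form in a frame. -/
def torsionCoeff (g : LeftInvariantMetric 𝔤) (e : Module.Basis (Fin 5) ℝ 𝔤) (i j k : Fin 5) : ℝ :=
  g.torsion (e i) (e j) (e k)

/-- The symmetric form `Z, Z' ↦ ∑ τ(e_i, e_j, Z) τ(e_i, e_j, Z')`, linear in `Z'`. -/
def torsionContraction (g : LeftInvariantMetric 𝔤) (e : Module.Basis (Fin 5) ℝ 𝔤) (Z : 𝔤) :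
    𝔤 →ₗ[ℝ] ℝ :=
  ∑ i, ∑ j, g.torsion (e i) (e j) Z • g.torsion (e i) (e j)

theorem torsionContraction_apply (g : LeftInvariantMetric 𝔤) (e : Module.Basis (Fin 5) ℝ 𝔤)
    (Z Z' : 𝔤) : g.torsionContraction e Z Z' =
      ∑ i, ∑ j, g.torsion (e i) (e j) Z * g.torsion (e i) (e j) Z' := by
  simp [torsionContraction]

theorem torsionContraction_comm (g : LeftInvariantMetric 𝔤) (e : Module.Basis (Fin 5) ℝ 𝔤)
    (Z Z' : 𝔤) : g.torsionContraction e Z Z' = g.torsionContraction e Z' Z := by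
  simp only [torsionContraction_apply, mul_comm]

/-- The two summation indices are exchanged for the other frame one at a time; cyclic symmetry
brings each into the last slot, where `torsion` is linear and `sum_mul_eq` applies. -/
theorem IsOrthonormal.torsionContraction_eq (he : g.IsOrthonormal e) (hf : g.IsOrthonormal f) :
    g.torsionContraction e = g.torsionContraction f := by
  ext Z Z'
  rw [torsionContraction_apply, torsionContraction_apply]
  have h1 (i : Fin 5) : ∑ j, g.torsion (e i) (e j) Z * g.torsion (e i) (e j) Z' =
      ∑ j, g.torsion (e i) (f j) Z * g.torsion (e i) (f j) Z' := by
    simp only [← g.torsion_cyclic _ (e i)]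
    exact he.sum_mul_eq hf (g.torsion Z (e i)) (g.torsion Z' (e i))
  simp only [h1]
  refine Finset.sum_comm.trans (Eq.trans ?_ Finset.sum_comm)
  refine Finset.sum_congr rfl fun j _ => ?_
  simp only [fun X Z => g.torsion_cyclic X (f j) Z]
  exact he.sum_mul_eq hf (g.torsion (f j) Z) (g.torsion (f j) Z')

theorem IsOrthonormal.sum_contraction_eq (he : g.IsOrthonormal e) (hf : g.IsOrthonormal f) :
    ∑ k, g.torsionContraction e (e k) (e k) = ∑ k, g.torsionContraction f (f k) (f k) := by
  rw [he.torsionContraction_eq hf]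
  simp only [torsionContraction_apply]
  refine Finset.sum_comm.trans (Eq.trans ?_ Finset.sum_comm)
  refine Finset.sum_congr rfl fun i _ => ?_
  refine Finset.sum_comm.trans (Eq.trans ?_ Finset.sum_comm)
  exact Finset.sum_congr rfl fun j _ => he.sum_mul_eq hf _ _

theorem IsOrthonormal.sum_contraction_sq_eq (he : g.IsOrthonormal e) (hf : g.IsOrthonormal f) :
    ∑ k, ∑ l, g.torsionContraction e (e k) (e l) ^ 2 =
      ∑ k, ∑ l, g.torsionContraction f (f k) (f l) ^ 2 := by
  rw [he.torsionContraction_eq hf]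
  have h (k : Fin 5) : ∑ l, g.torsionContraction f (e k) (e l) ^ 2 =
      ∑ l, g.torsionContraction f (e k) (f l) ^ 2 := by
    simp only [sq]; exact he.sum_mul_eq hf _ _
  simp only [h]
  refine Finset.sum_comm.trans (Eq.trans ?_ Finset.sum_comm)
  refine Finset.sum_congr rfl fun l _ => ?_
  simp only [fun X => g.torsionContraction_comm f X (f l), sq]
  exact he.sum_mul_eq hf _ _

end LeftInvariantMetric

end Frames

/-! ### Quadratic and quartic invariants of a 3-form -/

/-- Total antisymmetry of the components of a 3-form. -/
structure IsAlternating (T : Fin 5 → Fin 5 → Fin 5 → ℝ) : Prop where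
  left : ∀ i j k, T j i k = -T i j k
  right : ∀ i j k, T i k j = -T i j k

namespace IsAlternating

variable {T : Fin 5 → Fin 5 → Fin 5 → ℝ}

theorem left_of_lt (h : IsAlternating T) {i j : Fin 5} (_ : i < j) (k : Fin 5) :
    T j i k = -T i j k := h.left i j k

theorem right_of_lt (h : IsAlternating T) {j k : Fin 5} (_ : j < k) (i : Fin 5) :
    T i k j = -T i j k := h.right i j k

theorem left_self (h : IsAlternating T) (i k : Fin 5) : T i i k = 0 := by
  linarith [h.left i i k]

theorem right_self (h : IsAlternating T) (i j : Fin 5) : T i j j = 0 := by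
  linarith [h.right i j j]

theorem sum_sq (h : IsAlternating T) :
    ∑ k, ∑ i, ∑ j, T i j k * T i j k = 6 * cubicNorm T := by
  simp (disch := decide) only [Fin.sum_univ_five, h.left_of_lt, h.right_of_lt, h.left_self,
    h.right_self, cubicNorm]
  ring

-- With `B_{kl} = ∑ T_{ijk} T_{ijl}`, this reads `tr B² = 12 |T|⁴ - 4 ‖v‖²`, while `tr B = 6 |T|²`.
-- It exhibits `‖v‖²`, defined by coordinates, as an orthogonal invariant. It is a polynomial
-- identity in the ten independent components.
set_option maxHeartbeats 2000000 in
theorem sum_sum_sq (h : IsAlternating T) :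
    ∑ k, ∑ l, (∑ i, ∑ j, T i j k * T i j l) ^ 2 =
      12 * cubicNorm T ^ 2 - 4 * ∑ i, cubicVec T i ^ 2 := by
  simp (disch := decide) only [Fin.sum_univ_five, h.left_of_lt, h.right_of_lt, h.left_self,
    h.right_self, cubicNorm, cubicVec, Matrix.cons_val, neg_mul_neg, mul_zero, zero_mul, neg_neg,
    mul_neg, neg_mul, zero_add, add_zero, neg_zero]
  ring

end IsAlternating

/-! ### Frame independence of the invariants, and unimodularity -/

namespace LeftInvariantMetric

variable {𝔤 : Type*} [LieRing 𝔤] [LieAlgebra ℝ 𝔤] {g : LeftInvariantMetric 𝔤}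
  {e f : Module.Basis (Fin 5) ℝ 𝔤}

theorem isAlternating_torsionCoeff (g : LeftInvariantMetric 𝔤) (e : Module.Basis (Fin 5) ℝ 𝔤) :
    IsAlternating (g.torsionCoeff e) where
  left i j k := g.torsion_swap _ _ _
  right i j k := by
    simp only [torsionCoeff]
    rw [torsion_cyclic, torsion_swap, ← torsion_cyclic]

theorem IsOrthonormal.cubicNorm_eq (he : g.IsOrthonormal e) (hf : g.IsOrthonormal f) :
    cubicNorm (g.torsionCoeff e) = cubicNorm (g.torsionCoeff f) := by
  have h := he.sum_contraction_eq hf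
  simp only [torsionContraction_apply] at h
  have h1 := (g.isAlternating_torsionCoeff e).sum_sq
  have h2 := (g.isAlternating_torsionCoeff f).sum_sq
  simp only [torsionCoeff] at h1 h2 ⊢
  linarith

theorem IsOrthonormal.sum_cubicVec_sq_eq (he : g.IsOrthonormal e) (hf : g.IsOrthonormal f) :
    ∑ i, cubicVec (g.torsionCoeff e) i ^ 2 = ∑ i, cubicVec (g.torsionCoeff f) i ^ 2 := by
  have h := he.sum_contraction_sq_eq hf
  simp only [torsionContraction_apply] at h
  have h1 := (g.isAlternating_torsionCoeff e).sum_sum_sq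
  have h2 := (g.isAlternating_torsionCoeff f).sum_sum_sq
  have h3 := he.cubicNorm_eq hf
  rw [h3] at h1
  simp only [torsionCoeff] at h1 h2 ⊢
  linarith

/-- The sum is the trace of `ad X`, a nilpotent endomorphism. -/
theorem IsOrthonormal.sum_lie_inner_eq_zero [LieRing.IsNilpotent 𝔤] (he : g.IsOrthonormal e)
    (X : 𝔤) : ∑ j, g.inner ⁅X, e j⁆ (e j) = 0 := by
  have h : LinearMap.trace ℝ 𝔤 (LieAlgebra.ad ℝ 𝔤 X) = 0 := by
    have : Module.Finite ℝ 𝔤 := .of_basis e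
    have : Module.Free ℝ 𝔤 := .of_basis e
    refine (LinearMap.isNilpotent_trace_of_isNilpotent ?_).eq_zero
    exact LieModule.isNilpotent_toEnd_of_isNilpotent ℝ 𝔤 𝔤 X
  rw [LinearMap.trace_eq_matrix_trace ℝ e] at h
  simpa [Matrix.trace, LinearMap.toMatrix_apply, he.repr_eq] using h

end LeftInvariantMetric

/-! ### The Dirac operator on left-invariant spinors -/

/-- For distinct indices the three orderings of a triple add up to the cyclic sum of `c`. When `i`
equals `j` or `k`, the monomial collapses to a vector, and the collected coefficients of these
vectors are multiples of the traces in `htr`. -/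
theorem sum_spin_eq_cubic (c : Fin 5 → Fin 5 → Fin 5 → ℝ) (hc : ∀ i j k, c j i k = -c i j k)
    (htr : ∀ i, ∑ j, c i j j = 0) :
    ∑ i, ∑ j, ∑ k ∈ Finset.Ioi j, ((1 / 4 : ℝ) * (c i j k - c j k i + c k i j)) •
      (clGen i * (clGen j * clGen k)) =
    (1 / 4 : ℝ) • cubic fun i j k => c i j k + c j k i + c k i j := by
  have hlt {i j : Fin 5} (_ : i < j) (k : Fin 5) : c j i k = -c i j k := hc i j k
  have hself (i k : Fin 5) : c i i k = 0 := by linarith [hc i i k]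
  have h0 := htr 0
  have h1 := htr 1
  have h2 := htr 2
  have h3 := htr 3
  have h4 := htr 4
  have i0 : Finset.Ioi (0 : Fin 5) = {1, 2, 3, 4} := rfl
  have i1 : Finset.Ioi (1 : Fin 5) = {2, 3, 4} := rfl
  have i2 : Finset.Ioi (2 : Fin 5) = {3, 4} := rfl
  have i3 : Finset.Ioi (3 : Fin 5) = {4} := rfl
  have i4 : Finset.Ioi (4 : Fin 5) = ∅ := rfl
  simp (disch := decide) only [Fin.sum_univ_five, hlt, hself, zero_add, add_zero] at h0 h1 h2 h3 h4
  -- Each trace relation is solved for one coefficient, so that substituting it makes the vector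
  -- part cancel termwise.
  have r0 : c 0 1 1 = -c 0 2 2 - c 0 3 3 - c 0 4 4 := by linarith
  have r1 : c 0 1 0 = c 1 2 2 + c 1 3 3 + c 1 4 4 := by linarith
  have r2 : c 0 2 0 = -c 1 2 1 + c 2 3 3 + c 2 4 4 := by linarith
  have r3 : c 0 3 0 = -c 1 3 1 - c 2 3 2 + c 3 4 4 := by linarith
  have r4 : c 0 4 0 = -c 1 4 1 - c 2 4 2 - c 3 4 3 := by linarith
  simp only [Fin.sum_univ_five, i0, i1, i2, i3, i4, Finset.sum_empty, Finset.sum_singleton]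
  simp (disch := decide) only [Finset.sum_insert, Finset.sum_singleton, cubic, hlt, hself,
    mul_assoc, clGen_mul_swap, clGen_mul_swap_assoc, clGen_sq, clGen_sq_assoc, mul_neg, mul_one,
    r0, r1, r2, r3, r4]
  module

section Dirac

variable {G : Type*} [TopologicalSpace G] [ChartedSpace (EuclideanSpace ℝ (Fin 5)) G] [Group G]
  [LieGroup (𝓡 5) ∞ G]
  {W : Type*} [NormedAddCommGroup W] [NormedSpace ℝ W] [Module Cl5 W] [IsScalarTower ℝ Cl5 W]
  {g : LeftInvariantMetric (GroupLieAlgebra (𝓡 5) G)}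
  {e f : Module.Basis (Fin 5) ℝ (GroupLieAlgebra (𝓡 5) G)}

theorem IsLeftInvariantSpinor.eq_const {φ : G → W} (h : IsLeftInvariantSpinor φ) :
    φ = fun _ => φ 1 :=
  funext fun x => by simpa using h x 1

/-- The derivative of a constant vanishes. The factor `1/4` is the `1/2` of the spin connection
times the `1/2` of the Koszul formula; its square accounts for the `16` in `DiracSquareFormula`. -/
theorem dirac_const [LieRing.IsNilpotent (GroupLieAlgebra (𝓡 5) G)] (he : g.IsOrthonormal e)
    (w : W) (x : G) :
    dirac g e (fun _ => w) x = (1 / 4 : ℝ) • cubic (g.torsionCoeff e) • w := by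
  have h := sum_spin_eq_cubic (fun i j k => g.inner ⁅e i, e j⁆ (e k))
    (fun i j k => by rw [← lie_skew, map_neg, LinearMap.neg_apply])
    (fun i => he.sum_lie_inner_eq_zero (e i))
  have h' := congrArg (fun a : Cl5 => a • w) h
  simp only [smul_assoc] at h'
  refine Eq.trans ?_ h'
  simp only [dirac, spinConnection, mfderiv_const, Finset.sum_smul, Finset.smul_sum,
    smul_add, g.inner_leviCivita]
  refine Finset.sum_congr rfl fun i _ => ?_
  have hz : (0 : EuclideanSpace ℝ (Fin 5) →L[ℝ] W) (mulInvariantVectorField (I := 𝓡 5) (e i) x) = 0 :=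
    rfl
  refine (congrArg (fun y : W => clGen i • (y + _)) hz).trans ?_
  simp only [zero_add, Finset.smul_sum]
  refine Finset.sum_congr rfl fun j _ => Finset.sum_congr rfl fun k _ => ?_
  rw [smul_comm (clGen i), smul_comm (clGen i), smul_smul (clGen i), smul_smul, smul_assoc]
  congr 1
  ring

theorem diracSquareFormula [LieRing.IsNilpotent (GroupLieAlgebra (𝓡 5) G)]
    (he : g.IsOrthonormal e) (hμ : muConst e = cubicNorm (g.torsionCoeff e)) :
    DiracSquareFormula W g e (cubicVec (g.torsionCoeff e)) := by
  intro φ hφ x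
  rw [hφ.eq_const]
  have h : dirac g e (fun _ : G => φ 1) =
      fun _ => (1 / 4 : ℝ) • cubic (g.torsionCoeff e) • φ 1 := funext (dirac_const he _)
  rw [h, dirac_const he, hμ, ← cubic_smul_smul, smul_comm (cubic _) (1 / 4 : ℝ), smul_smul,
    smul_smul]
  norm_num

/-- Spinors are trivialized by `f`, while the criterion is evaluated in `e`, where the structure
constants are known; invariance of the two numbers connects them. -/
theorem hasHarmonicSpinor_iff [LieRing.IsNilpotent (GroupLieAlgebra (𝓡 5) G)] [Nontrivial W]
    (Γ : Subgroup G) (he : g.IsOrthonormal e) (hf : g.IsOrthonormal f) :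
    HasHarmonicSpinor W Γ g f ↔
      cubicNorm (g.torsionCoeff e) ^ 2 = ∑ i, cubicVec (g.torsionCoeff e) i ^ 2 := by
  rw [he.cubicNorm_eq hf, he.sum_cubicVec_sq_eq hf, ← exists_cubic_smul_eq_zero_iff (W := W)]
  constructor
  · rintro ⟨ε, φ, -, hinv, hne, hD⟩
    refine ⟨φ 1, fun h => hne ?_, ?_⟩
    · rw [hinv.eq_const, h]; rfl
    · have := hD 1
      rw [hinv.eq_const, dirac_const hf] at this
      simpa using this
  · rintro ⟨w, hw, h⟩
    -- A constant map is a section for the trivial homomorphism `ε = 1`.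
    refine ⟨1, fun _ => w, ⟨contMDiff_const, fun γ x => by simp⟩, fun _ _ => rfl,
      fun h0 => hw (congrFun h0 1), fun x => ?_⟩
    rw [dirac_const hf, h, smul_zero]

end Dirac

section Algebra

variable {𝔤 : Type*} [LieRing 𝔤] [LieAlgebra ℝ 𝔤]

/-! ### Changing bases -/

theorem exists_basis_of_det_ne_zero (e : Module.Basis (Fin 5) ℝ 𝔤) (P : Matrix (Fin 5) (Fin 5) ℝ)
    (hP : P.det ≠ 0) : ∃ b : Module.Basis (Fin 5) ℝ 𝔤, ∀ i, b i = ∑ j, P i j • e j := by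
  set v : Fin 5 → 𝔤 := fun i => ∑ j, P i j • e j
  have hv : e.toMatrix v = P.transpose := by
    ext i j
    simp [Module.Basis.toMatrix_apply, v, Finsupp.single_apply]
  obtain ⟨h1, h2⟩ := (Module.Basis.is_basis_iff_det e (v := v)).2
    (by rw [Module.Basis.det_apply, hv, Matrix.det_transpose]; exact isUnit_iff_ne_zero.2 hP)
  exact ⟨Module.Basis.mk h1 h2.ge, fun i => by simp [v]⟩

theorem structureEqs_iff (e : Module.Basis (Fin 5) ℝ 𝔤) (a b c : Matrix (Fin 5) (Fin 5) ℝ)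
    (ha : a.transpose = -a) (hb : b.transpose = -b) (hc : c.transpose = -c) :
    StructureEqs e a b c ↔
      ∀ i j, i < j → ⁅e i, e j⁆ = -(a i j • e 2 + b i j • e 3 + c i j • e 4) := by
  constructor
  · rintro ⟨h0, h1, h2, h3, h4⟩ i j -
    rw [← e.sum_repr ⁅e i, e j⁆, Fin.sum_univ_five]
    have h0 := congrFun (congrFun h0 i) j
    have h1 := congrFun (congrFun h1 i) j
    have h2 := congrFun (congrFun h2 i) j
    have h3 := congrFun (congrFun h3 i) j
    have h4 := congrFun (congrFun h4 i) j
    simp only [coframeDiff, Matrix.of_apply, Matrix.zero_apply, neg_eq_zero] at h0 h1 h2 h3 h4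
    rw [h0, h1, ← h2, ← h3, ← h4]
    module
  · intro h
    have hs (m : Matrix (Fin 5) (Fin 5) ℝ) (hm : m.transpose = -m) (i j) : m j i = -m i j :=
      congrFun (congrFun hm i) j
    have h' (i j) : ⁅e i, e j⁆ = -(a i j • e 2 + b i j • e 3 + c i j • e 4) := by
      rcases lt_trichotomy i j with hij | rfl | hij
      · exact h i j hij
      · rw [lie_self, show a i i = 0 by linarith [hs a ha i i],
          show b i i = 0 by linarith [hs b hb i i], show c i i = 0 by linarith [hs c hc i i]]
        simp
      · rw [← lie_skew, h j i hij, hs a ha, hs b hb, hs c hc]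
        module
    refine ⟨?_, ?_, ?_, ?_, ?_⟩ <;> ext i j <;> simp [coframeDiff, h', Finsupp.single_apply]

/-- Structure equations in terms of brackets, up to the sign of the basis. -/
theorem exists_structureEqs_iff (a b c : Matrix (Fin 5) (Fin 5) ℝ) (ha : a.transpose = -a)
    (hb : b.transpose = -b) (hc : c.transpose = -c) :
    (∃ e : Module.Basis (Fin 5) ℝ 𝔤, StructureEqs e a b c) ↔
      ∃ e : Module.Basis (Fin 5) ℝ 𝔤, ∀ i j, i < j →
        ⁅e i, e j⁆ = a i j • e 2 + b i j • e 3 + c i j • e 4 := by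
  constructor
  · rintro ⟨e, he⟩
    refine ⟨e.map (LinearEquiv.neg ℝ), fun i j hij => ?_⟩
    simp [(structureEqs_iff e a b c ha hb hc).1 he i j hij]
    abel
  · rintro ⟨e, he⟩
    refine ⟨e.map (LinearEquiv.neg ℝ), (structureEqs_iff _ a b c ha hb hc).2 fun i j hij => ?_⟩
    simp [he i j hij]
    abel

theorem transpose_wedge (i j : Fin 5) : (wedge i j).transpose = -wedge i j := by
  simp [wedge]

theorem wedge_apply (i j k l : Fin 5) :
    wedge i j k l = (if i = k ∧ j = l then 1 else 0) - (if j = k ∧ i = l then 1 else 0) := by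
  simp [wedge, Matrix.single_apply]

/-- In the basis `e`, the brackets are `[e_1,e_2] = a e_3 + b e_4 + c e_5`,
`[e_1,e_3] = d e_4 + p e_5`, `[e_2,e_3] = f e_4 + q e_5`, `[e_1,e_4] = h e_5`, `[e_2,e_4] = k e_5`,
`[e_3,e_4] = m e_5`, and `e_5` is central. -/
def HasBrackets (e : Module.Basis (Fin 5) ℝ 𝔤) (a b c d p f q h k m : ℝ) : Prop :=
  ⁅e 0, e 1⁆ = a • e 2 + b • e 3 + c • e 4 ∧ ⁅e 0, e 2⁆ = d • e 3 + p • e 4 ∧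
  ⁅e 0, e 3⁆ = h • e 4 ∧ ⁅e 0, e 4⁆ = 0 ∧ ⁅e 1, e 2⁆ = f • e 3 + q • e 4 ∧ ⁅e 1, e 3⁆ = k • e 4 ∧
  ⁅e 1, e 4⁆ = 0 ∧ ⁅e 2, e 3⁆ = m • e 4 ∧ ⁅e 2, e 4⁆ = 0 ∧ ⁅e 3, e 4⁆ = 0

/-- The bracket of `HasBrackets` in coordinates. -/
def coordBracket (a b c d p f q h k m : ℝ) (x y : Fin 5 → ℝ) : Fin 5 → ℝ :=
  ![0, 0, a * (x 0 * y 1 - x 1 * y 0),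
    b * (x 0 * y 1 - x 1 * y 0) + d * (x 0 * y 2 - x 2 * y 0) + f * (x 1 * y 2 - x 2 * y 1),
    c * (x 0 * y 1 - x 1 * y 0) + p * (x 0 * y 2 - x 2 * y 0) + q * (x 1 * y 2 - x 2 * y 1) +
      h * (x 0 * y 3 - x 3 * y 0) + k * (x 1 * y 3 - x 3 * y 1) + m * (x 2 * y 3 - x 3 * y 2)]

section

variable {e : Module.Basis (Fin 5) ℝ 𝔤} {a b c d p f q h k m : ℝ}

theorem HasBrackets.lie_sum (H : HasBrackets e a b c d p f q h k m) (x y : Fin 5 → ℝ) :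
    ⁅∑ i, x i • e i, ∑ i, y i • e i⁆ = ∑ i, coordBracket a b c d p f q h k m x y i • e i := by
  obtain ⟨h01, h02, h03, h04, h12, h13, h14, h23, h24, h34⟩ := H
  have hs {i j : Fin 5} (_ : i < j) : ⁅e j, e i⁆ = -⁅e i, e j⁆ := (lie_skew _ _).symm
  simp (disch := decide) only [Fin.sum_univ_five, coordBracket, Matrix.cons_val, add_lie, lie_add,
    smul_lie, lie_smul, hs, lie_self, h01, h02, h03, h04, h12, h13, h14, h23, h24, h34]
  module

/-- The brackets in a new basis, the rows of `P` being its coordinates in the old one. -/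
theorem HasBrackets.of_coords {e' : Module.Basis (Fin 5) ℝ 𝔤}
    (H : HasBrackets e a b c d p f q h k m) (P : Fin 5 → Fin 5 → ℝ)
    (he' : ∀ i, e' i = ∑ j, P i j • e j) (a' b' c' d' p' f' q' h' k' m' : ℝ)
    (hC : let C := coordBracket a b c d p f q h k m
      C (P 0) (P 1) = a' • P 2 + b' • P 3 + c' • P 4 ∧ C (P 0) (P 2) = d' • P 3 + p' • P 4 ∧
      C (P 0) (P 3) = h' • P 4 ∧ C (P 0) (P 4) = 0 ∧ C (P 1) (P 2) = f' • P 3 + q' • P 4 ∧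
      C (P 1) (P 3) = k' • P 4 ∧ C (P 1) (P 4) = 0 ∧ C (P 2) (P 3) = m' • P 4 ∧
      C (P 2) (P 4) = 0 ∧ C (P 3) (P 4) = 0) :
    HasBrackets e' a' b' c' d' p' f' q' h' k' m' := by
  obtain ⟨h01, h02, h03, h04, h12, h13, h14, h23, h24, h34⟩ := hC
  simp only [HasBrackets, he', Matrix.of_apply, H.lie_sum, h01, h02, h03, h04, h12, h13, h14, h23,
    h24, h34, Finset.smul_sum, ← Finset.sum_add_distrib, smul_smul, ← add_smul, Pi.add_apply,
    Pi.smul_apply, smul_eq_mul, Pi.zero_apply, zero_smul, Finset.sum_const_zero, and_self]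

theorem HasBrackets.change (H : HasBrackets e a b c d p f q h k m) (P : Fin 5 → Fin 5 → ℝ)
    (hP : (Matrix.of P).det ≠ 0) (a' b' c' d' p' f' q' h' k' m' : ℝ)
    (hC : let C := coordBracket a b c d p f q h k m
      C (P 0) (P 1) = a' • P 2 + b' • P 3 + c' • P 4 ∧ C (P 0) (P 2) = d' • P 3 + p' • P 4 ∧
      C (P 0) (P 3) = h' • P 4 ∧ C (P 0) (P 4) = 0 ∧ C (P 1) (P 2) = f' • P 3 + q' • P 4 ∧
      C (P 1) (P 3) = k' • P 4 ∧ C (P 1) (P 4) = 0 ∧ C (P 2) (P 3) = m' • P 4 ∧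
      C (P 2) (P 4) = 0 ∧ C (P 3) (P 4) = 0) :
    ∃ e' : Module.Basis (Fin 5) ℝ 𝔤, HasBrackets e' a' b' c' d' p' f' q' h' k' m' := by
  obtain ⟨e', he'⟩ := exists_basis_of_det_ne_zero e (Matrix.of P) hP
  exact ⟨e', H.of_coords P he' _ _ _ _ _ _ _ _ _ _ hC⟩

/-- Here and for the next seven models, the minus sign in `dα(X,Y) = -α([X,Y])` is absorbed by
replacing `e` with `-e`. -/
theorem isL3A2_iff : IsL3A2 𝔤 ↔ ∃ e : Module.Basis (Fin 5) ℝ 𝔤, HasBrackets e 0 0 1 0 0 0 0 0 0 0 := by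
  rw [IsL3A2, exists_structureEqs_iff _ _ _ (by simp [transpose_wedge, add_comm])
    (by simp [transpose_wedge, add_comm]) (by simp [transpose_wedge, add_comm])]
  simp [Fin.forall_fin_succ, wedge_apply, HasBrackets, and_assoc]

theorem isL4A1_iff : IsL4A1 𝔤 ↔ ∃ e : Module.Basis (Fin 5) ℝ 𝔤, HasBrackets e 0 1 0 0 0 0 0 1 0 0 := by
  rw [IsL4A1, exists_structureEqs_iff _ _ _ (by simp [transpose_wedge, add_comm])
    (by simp [transpose_wedge, add_comm]) (by simp [transpose_wedge, add_comm])]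
  simp [Fin.forall_fin_succ, wedge_apply, HasBrackets, and_assoc]

theorem isN56_iff : IsN56 𝔤 ↔ ∃ e : Module.Basis (Fin 5) ℝ 𝔤, HasBrackets e 0 0 1 0 0 0 0 0 0 1 := by
  rw [IsN56, exists_structureEqs_iff _ _ _ (by simp [transpose_wedge, add_comm])
    (by simp [transpose_wedge, add_comm]) (by simp [transpose_wedge, add_comm])]
  simp [Fin.forall_fin_succ, wedge_apply, HasBrackets, and_assoc]

theorem isN55_iff : IsN55 𝔤 ↔ ∃ e : Module.Basis (Fin 5) ℝ 𝔤, HasBrackets e 0 1 0 0 1 0 0 0 0 0 := by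
  rw [IsN55, exists_structureEqs_iff _ _ _ (by simp [transpose_wedge, add_comm])
    (by simp [transpose_wedge, add_comm]) (by simp [transpose_wedge, add_comm])]
  simp [Fin.forall_fin_succ, wedge_apply, HasBrackets, and_assoc]

theorem isN54_iff : IsN54 𝔤 ↔ ∃ e : Module.Basis (Fin 5) ℝ 𝔤, HasBrackets e 0 1 0 0 0 0 1 1 0 0 := by
  rw [IsN54, exists_structureEqs_iff _ _ _ (by simp [transpose_wedge, add_comm])
    (by simp [transpose_wedge, add_comm]) (by simp [transpose_wedge, add_comm])]
  simp [Fin.forall_fin_succ, wedge_apply, HasBrackets, and_assoc]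

theorem isN53_iff : IsN53 𝔤 ↔ ∃ e : Module.Basis (Fin 5) ℝ 𝔤, HasBrackets e 1 0 0 1 0 0 1 0 0 0 := by
  rw [IsN53, exists_structureEqs_iff _ _ _ (by simp [transpose_wedge, add_comm])
    (by simp [transpose_wedge, add_comm]) (by simp [transpose_wedge, add_comm])]
  simp [Fin.forall_fin_succ, wedge_apply, HasBrackets, and_assoc]

theorem isN52_iff : IsN52 𝔤 ↔ ∃ e : Module.Basis (Fin 5) ℝ 𝔤, HasBrackets e 1 0 0 1 0 0 0 1 0 0 := by
  rw [IsN52, exists_structureEqs_iff _ _ _ (by simp [transpose_wedge, add_comm])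
    (by simp [transpose_wedge, add_comm]) (by simp [transpose_wedge, add_comm])]
  simp [Fin.forall_fin_succ, wedge_apply, HasBrackets, and_assoc]

theorem isN51_iff : IsN51 𝔤 ↔ ∃ e : Module.Basis (Fin 5) ℝ 𝔤, HasBrackets e 1 0 0 1 0 0 1 1 0 0 := by
  rw [IsN51, exists_structureEqs_iff _ _ _ (by simp [transpose_wedge, add_comm])
    (by simp [transpose_wedge, add_comm]) (by simp [transpose_wedge, add_comm])]
  simp [Fin.forall_fin_succ, wedge_apply, HasBrackets, and_assoc]

end

end Algebra

section Classification

variable {𝔤 : Type*} [LieRing 𝔤] [LieAlgebra ℝ 𝔤]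

/-! ### Nilpotent frames -/

/-- Take the first term of the lower central series contained in `S`; any element of the preceding
term outside `S` will do. -/
theorem exists_notMem_forall_lie_mem [LieRing.IsNilpotent 𝔤] (S : Submodule ℝ 𝔤) (hS : S ≠ ⊤) :
    ∃ x, x ∉ S ∧ ∀ X : 𝔤, ⁅X, x⁆ ∈ S := by
  have hex : ∃ k, (LieModule.lowerCentralSeries ℝ 𝔤 𝔤 k).toSubmodule ≤ S := by
    obtain ⟨k, hk⟩ := LieModule.IsNilpotent.nilpotent ℝ 𝔤 𝔤
    exact ⟨k, by simp [hk]⟩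
  classical
  have hk := Nat.find_spec hex
  have hmin := fun m => Nat.find_min hex (m := m)
  rcases hn : Nat.find hex with _ | n
  · rw [hn] at hk
    exact absurd (top_le_iff.1 (by simpa using hk)) hS
  · rw [hn] at hk hmin
    obtain ⟨x, hx, hxS⟩ := Set.not_subset.1 (hmin n n.lt_succ_self)
    refine ⟨x, hxS, fun X => hk ?_⟩
    rw [LieModule.lowerCentralSeries_succ]
    exact LieSubmodule.lie_mem_lie (LieSubmodule.mem_top X) hx

theorem exists_central_flag [LieRing.IsNilpotent 𝔤] [FiniteDimensional ℝ 𝔤] (n : ℕ)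
    (hn : n ≤ Module.finrank ℝ 𝔤) : ∃ v : Fin n → 𝔤, LinearIndependent ℝ v ∧
      ∀ i, ∀ X : 𝔤, ⁅X, v i⁆ ∈ Submodule.span ℝ (v '' Set.Iio i) := by
  induction n with
  | zero => exact ⟨Fin.elim0, linearIndependent_empty_type, fun i => i.elim0⟩
  | succ n ih =>
    obtain ⟨v, hv, hl⟩ := ih (by omega)
    obtain ⟨x, hx, hxl⟩ := exists_notMem_forall_lie_mem (Submodule.span ℝ (Set.range v)) (by
      intro h
      have := finrank_span_eq_card hv
      rw [h, finrank_top, Fintype.card_fin] at this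
      omega)
    refine ⟨Fin.snoc v x, linearIndependent_finSnoc.2 ⟨hv, hx⟩, fun i X => ?_⟩
    induction i using Fin.lastCases with
    | last =>
      rw [Fin.snoc_last]
      refine Submodule.span_mono ?_ (hxl X)
      rintro _ ⟨j, rfl⟩
      exact ⟨j.castSucc, Fin.castSucc_lt_last j, by simp⟩
    | cast i =>
      rw [Fin.snoc_castSucc]
      refine Submodule.span_mono ?_ (hl i X)
      rintro _ ⟨j, hj, rfl⟩
      exact ⟨j.castSucc, by simpa using hj, by simp⟩

theorem exists_isNilpotentFrame [LieRing.IsNilpotent 𝔤] (h5 : Module.finrank ℝ 𝔤 = 5) :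
    ∃ e : Module.Basis (Fin 5) ℝ 𝔤, IsNilpotentFrame e := by
  have : FiniteDimensional ℝ 𝔤 := .of_finrank_pos (by omega)
  obtain ⟨v, hv, hl⟩ := exists_central_flag (𝔤 := 𝔤) 5 h5.ge
  -- The flag is built from the centre upwards, so its order is reversed: the central vector becomes
  -- the last one and brackets raise the index.
  set e := (basisOfLinearIndependentOfCardEqFinrank hv (by simp [h5])).reindex Fin.revPerm
  have he (i) : e i = v i.rev := by simp [e]
  have key (X : 𝔤) (i k : Fin 5) (hk : k ≤ i) : e.repr ⁅X, e i⁆ k = 0 := by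
    have h1 : ⁅X, e i⁆ ∈ Submodule.span ℝ (e '' Set.Ioi i) := by
      rw [he]
      refine Submodule.span_mono ?_ (hl _ X)
      rintro _ ⟨j, hj, rfl⟩
      refine ⟨j.rev, ?_, by simp [he]⟩
      simpa [Fin.lt_rev_iff] using hj
    by_contra h
    exact absurd ((Module.Basis.mem_span_image _).1 h1 (Finsupp.mem_support_iff.2 h)) (not_lt.2 hk)
  refine ⟨e, fun i j k hk => ?_⟩
  rcases hk with hk | hk
  · rw [← lie_skew, map_neg, Finsupp.neg_apply, key _ _ _ hk, neg_zero]
  · exact key _ _ _ hk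

theorem IsNilpotentFrame.exists_hasBrackets {e : Module.Basis (Fin 5) ℝ 𝔤}
    (he : IsNilpotentFrame e) : ∃ a b c d p f q h k m, HasBrackets e a b c d p f q h k m := by
  refine ⟨e.repr ⁅e 0, e 1⁆ 2, e.repr ⁅e 0, e 1⁆ 3, e.repr ⁅e 0, e 1⁆ 4, e.repr ⁅e 0, e 2⁆ 3,
    e.repr ⁅e 0, e 2⁆ 4, e.repr ⁅e 1, e 2⁆ 3, e.repr ⁅e 1, e 2⁆ 4, e.repr ⁅e 0, e 3⁆ 4,
    e.repr ⁅e 1, e 3⁆ 4, e.repr ⁅e 2, e 3⁆ 4, ?_⟩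
  have h (i j k) (hk : k ≤ j) : e.repr ⁅e i, e j⁆ k = 0 := he i j k (Or.inr hk)
  have hs (X : 𝔤) := (e.sum_repr X).symm
  refine ⟨?_, ?_, ?_, ?_, ?_, ?_, ?_, ?_, ?_, ?_⟩ <;> conv_lhs => rw [hs ⁅_, _⁆, Fin.sum_univ_five]
  all_goals simp (disch := decide) [h]

end Classification

section Classification

variable {𝔤 : Type*} [LieRing 𝔤] [LieAlgebra ℝ 𝔤]

/-! ### Classification of the five-dimensional nilpotent Lie algebras -/

variable {e : Module.Basis (Fin 5) ℝ 𝔤} {a b c d p f q h k m : ℝ}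

/-- Only the triples `(e_1, e_2, e_4)` and `(e_1, e_2, e_3)` give non-trivial Jacobi identities, and
both land in the line of `e_5`. -/
theorem HasBrackets.jacobi (H : HasBrackets e a b c d p f q h k m) :
    a * m = 0 ∧ b * m + f * h - d * k = 0 := by
  obtain ⟨h01, h02, h03, h04, h12, h13, h14, h23, h24, h34⟩ := H
  have hs {i j : Fin 5} (_ : i < j) : ⁅e j, e i⁆ = -⁅e i, e j⁆ := (lie_skew _ _).symm
  have j1 := lie_jacobi (e 0) (e 1) (e 3)
  have j2 := lie_jacobi (e 0) (e 1) (e 2)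
  simp (disch := decide) only [hs, lie_neg, lie_add, lie_smul, h01, h02, h03, h04, h12, h13, h14,
    h23, h24, h34, lie_self, smul_zero, add_zero, zero_add, neg_zero, smul_smul, smul_neg,
    neg_neg, neg_add] at j1 j2
  have h4 : e 4 ≠ 0 := e.ne_zero 4
  constructor
  · have : (a * m) • e 4 = 0 := by rw [← neg_eq_zero, ← j1]
    exact (smul_eq_zero.1 this).resolve_right h4
  · have : (b * m + f * h - d * k) • e 4 = 0 := by rw [← j2]; module
    exact (smul_eq_zero.1 this).resolve_right h4

/-- One of the eight non-abelian algebras. -/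
def IsListed (𝔤 : Type*) [LieRing 𝔤] [LieAlgebra ℝ 𝔤] : Prop :=
  IsL3A2 𝔤 ∨ IsL4A1 𝔤 ∨ IsN56 𝔤 ∨ IsN55 𝔤 ∨ IsN54 𝔤 ∨ IsN53 𝔤 ∨ IsN52 𝔤 ∨ IsN51 𝔤

/-- The algebra is determined by which of `h`, `q` vanish. The new basis consists of the generators
`e_1`, `e_2` and iterated brackets, completed by a central vector where these do not span. -/
theorem HasBrackets.isListed_of_filiform (H : HasBrackets e a b c d p 0 q h 0 0) (ha : a ≠ 0)
    (hd : d ≠ 0) : IsListed 𝔤 := by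
  by_cases hh : h = 0
  · subst hh
    by_cases hq : q = 0
    · subst hq
      refine .inr (.inl (isL4A1_iff.2 (H.change ![![1, 0, 0, 0, 0], ![0, 1, 0, 0, 0],
        ![0, 0, 0, 0, 1], ![0, 0, a, b, c], ![0, 0, 0, a * d, a * p]] ?_ _ _ _ _ _ _ _ _ _ _ ?_)))
      · simp [Matrix.det_succ_row_zero, Fin.sum_univ_succ, Fin.succAbove, ha, hd]
      · simp [coordBracket, funext_iff, Fin.forall_fin_succ]
        grind
    · refine .inr (.inr (.inr (.inr (.inr (.inl (isN53_iff.2 (H.change ![![1, 0, 0, 0, 0], ![0, 1, 0, 0, 0],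
        ![0, 0, a, b, c], ![0, 0, 0, a * d, a * p], ![0, 0, 0, 0, a * q]] ?_ _ _ _ _ _ _ _ _ _ _ ?_)))))))
      · simp [Matrix.det_succ_row_zero, Fin.sum_univ_succ, Fin.succAbove, ha, hd, hq]
      · simp [coordBracket, funext_iff, Fin.forall_fin_succ]
        grind
  · by_cases hq : q = 0
    · subst hq
      refine .inr (.inr (.inr (.inr (.inr (.inr (.inl (isN52_iff.2 (H.change ![![1, 0, 0, 0, 0], ![0, 1, 0, 0, 0],
        ![0, 0, a, b, c], ![0, 0, 0, a * d, a * p + b * h], ![0, 0, 0, 0, a * d * h]] ?_ _ _ _ _ _ _ _ _ _ _ ?_))))))))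
      · simp [Matrix.det_succ_row_zero, Fin.sum_univ_succ, Fin.succAbove, ha, hd, hh]
      · simp [coordBracket, funext_iff, Fin.forall_fin_succ]
        grind
    -- Scaling the second generator by `t` multiplies `[e_1,[e_1,[e_1,e_2]]]` by `t` and
    -- `[e_2,[e_1,e_2]]` by `t²`; they agree for `t = dh/q`.
    · refine .inr (.inr (.inr (.inr (.inr (.inr (.inr ((isN51_iff.2 (H.change ![![1, 0, 0, 0, 0],
        ![0, d * h / q, 0, 0, 0], (d * h / q) • ![0, 0, a, b, c],
        (d * h / q) • ![0, 0, 0, a * d, a * p + b * h],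
        (d * h / q) • ![0, 0, 0, 0, a * d * h]] ?_ _ _ _ _ _ _ _ _ _ _ ?_)))))))))
      · simp [Matrix.det_succ_row_zero, Fin.sum_univ_succ, Fin.succAbove, ha, hd, hh, hq]
      · simp [coordBracket, funext_iff, Fin.forall_fin_succ]
        grind

/-- The pairs `(p,q)` and `(h,k)` are the covectors on `⟨e_1, e_2⟩` giving the brackets with `e_3`
and `e_4`. The cases are: both zero, only `(p,q)` zero, and `(p,q) ≠ 0` with `pk - qh` zero or not.
-/
theorem HasBrackets.isListed_of_heisenberg (H : HasBrackets e 1 0 0 0 p 0 q h k 0) :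
    IsListed 𝔤 := by
  by_cases hn : p ^ 2 + q ^ 2 = 0
  · have hp : p = 0 := by nlinarith
    have hq : q = 0 := by nlinarith
    subst hp hq
    by_cases hn' : h ^ 2 + k ^ 2 = 0
    · have hh : h = 0 := by nlinarith
      have hk : k = 0 := by nlinarith
      subst hh hk
      refine .inl (isL3A2_iff.2 (H.change ![![1, 0, 0, 0, 0], ![0, 1, 0, 0, 0],
        ![0, 0, 0, 0, 1], ![0, 0, 0, 1, 0], ![0, 0, 1, 0, 0]] ?_ _ _ _ _ _ _ _ _ _ _ ?_))
      · simp [Matrix.det_succ_row_zero, Fin.sum_univ_succ, Fin.succAbove]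
      · simp [coordBracket, funext_iff, Fin.forall_fin_succ]
    · refine .inr (.inr (.inr (.inl (isN55_iff.2 (H.change ![![h / (h ^ 2 + k ^ 2), k / (h ^ 2 + k ^ 2), 0, 0, 0],
        ![-k, h, 0, 0, 0], ![0, 0, 0, 1, 0], ![0, 0, 1, 0, 0], ![0, 0, 0, 0, 1]] ?_ _ _ _ _ _ _ _ _ _ _ ?_)))))
      · simp [Matrix.det_succ_row_zero, Fin.sum_univ_succ, Fin.succAbove]
        grind
      · simp [coordBracket, funext_iff, Fin.forall_fin_succ]
        grind
  -- A unimodular change of the plane turns `(p,q)` into `(1,0)`, and subtracting a multiple of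
  -- `e_3` from `e_4` removes its bracket with the first vector. What remains is the determinant
  -- `r`.
  · obtain ⟨e', H⟩ := H.change ![![p / (p ^ 2 + q ^ 2), q / (p ^ 2 + q ^ 2), 0, 0, 0],
      ![-q, p, 0, 0, 0], ![0, 0, 1, 0, 0],
      ![0, 0, -((p * h + q * k) / (p ^ 2 + q ^ 2)), 1, 0], ![0, 0, 0, 0, 1]]
      (by simp [Matrix.det_succ_row_zero, Fin.sum_univ_succ, Fin.succAbove]; grind)
      1 0 0 0 1 0 0 0 (p * k - q * h) 0
      (by simp [coordBracket, funext_iff, Fin.forall_fin_succ]; grind)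
    set r := p * k - q * h
    by_cases hr : r = 0
    · rw [hr] at H
      refine .inr (.inl (isL4A1_iff.2 (H.change ![![1, 0, 0, 0, 0], ![0, 1, 0, 0, 0],
        ![0, 0, 0, 1, 0], ![0, 0, 1, 0, 0], ![0, 0, 0, 0, 1]] ?_ _ _ _ _ _ _ _ _ _ _ ?_)))
      · simp [Matrix.det_succ_row_zero, Fin.sum_univ_succ, Fin.succAbove]
      · simp [coordBracket, funext_iff, Fin.forall_fin_succ]
    · refine .inr (.inr (.inr (.inr (.inl (isN54_iff.2 (H.change ![![1, 0, 0, 0, 0], ![0, 1, 0, 0, 0],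
        ![0, 0, 0, 1 / r, 0], ![0, 0, 1, 0, 0], ![0, 0, 0, 0, 1]] ?_ _ _ _ _ _ _ _ _ _ _ ?_))))))
      · simp [Matrix.det_succ_row_zero, Fin.sum_univ_succ, Fin.succAbove, hr]
      · simp [coordBracket, funext_iff, Fin.forall_fin_succ]
        grind

theorem HasBrackets.isListed_of_ne_zero (H : HasBrackets e a b c d p f q h k m) (ha : a ≠ 0) :
    IsListed 𝔤 := by
  obtain ⟨j1, j2⟩ := H.jacobi
  obtain rfl : m = 0 := (mul_eq_zero.1 j1).resolve_left ha
  by_cases hn : d ^ 2 + f ^ 2 = 0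
  · have hd : d = 0 := by nlinarith
    have hf : f = 0 := by nlinarith
    subst hd hf
    obtain ⟨e', H⟩ := H.change ![![1, 0, 0, 0, 0], ![0, 1, 0, 0, 0], ![0, 0, a, b, c],
      ![0, 0, 0, 1, 0], ![0, 0, 0, 0, 1]]
      (by simp [Matrix.det_succ_row_zero, Fin.sum_univ_succ, Fin.succAbove, ha])
      1 0 0 0 (a * p + b * h) 0 (a * q + b * k) h k 0
      (by simp [coordBracket, funext_iff, Fin.forall_fin_succ]; grind)
    exact H.isListed_of_heisenberg
  -- The plane change turns `(d,f)` into `(1,0)`. The new `k` is `dk - fh`, which vanishes by Jacobi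
  -- since `m = 0`.
  · obtain ⟨e', H⟩ := H.change ![![d / (d ^ 2 + f ^ 2), f / (d ^ 2 + f ^ 2), 0, 0, 0],
      ![-f, d, 0, 0, 0], ![0, 0, 1, 0, 0], ![0, 0, 0, 1, 0], ![0, 0, 0, 0, 1]]
      (by simp [Matrix.det_succ_row_zero, Fin.sum_univ_succ, Fin.succAbove]; grind)
      a b c 1 ((d * p + f * q) / (d ^ 2 + f ^ 2)) 0 (d * q - f * p)
      ((d * h + f * k) / (d ^ 2 + f ^ 2)) 0 0
      (by simp [coordBracket, funext_iff, Fin.forall_fin_succ]; grind)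
    exact H.isListed_of_filiform ha one_ne_zero

theorem HasBrackets.isListed_of_ne_zero_right (H : HasBrackets e 0 b c d p f q h k m)
    (hb : b ≠ 0) : IsListed 𝔤 := by
  obtain ⟨-, j2⟩ := H.jacobi
  -- The bracket of the first two vectors takes the third place. The combination `f e_1 - d e_2 + b
  -- e_3` is chosen so that its brackets with `e_1` and `e_2` have no `e_4` component; Jacobi makes
  -- it commute with the new third vector.
  obtain ⟨e', H⟩ := H.change ![![1, 0, 0, 0, 0], ![0, 1 / b, 0, 0, 0], ![0, 0, 0, 1, c / b],
    ![f, -d, b, 0, 0], ![0, 0, 0, 0, 1]]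
    (by simp [Matrix.det_succ_row_zero, Fin.sum_univ_succ, Fin.succAbove, hb])
    1 0 0 0 h 0 (k / b) (b * p - d * c) (q - f * c / b) 0
    (by simp [coordBracket, funext_iff, Fin.forall_fin_succ]; grind)
  exact H.isListed_of_heisenberg

/-- The bracket is a 2-form on four variables with values in the centre. Correcting `e_3` and `e_4`
to commute with `e_1` and `e_2` leaves one number, the Pfaffian `cm - pk + hq` divided by `c`; it
tells rank two from rank four. -/
theorem HasBrackets.isListed_of_form (H : HasBrackets e 0 0 c 0 p 0 q h k m) (hc : c ≠ 0) :
    IsListed 𝔤 := by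
  by_cases hr : m + (h * q - k * p) / c = 0
  · refine .inl (isL3A2_iff.2 (H.change ![![1, 0, 0, 0, 0], ![0, 1, 0, 0, 0],
      ![q / c, -p / c, 1, 0, 0], ![k / c, -h / c, 0, 1, 0], ![0, 0, 0, 0, c]] ?_ _ _ _ _ _ _ _ _ _ _ ?_))
    · simp [Matrix.det_succ_row_zero, Fin.sum_univ_succ, Fin.succAbove, hc]
    · simp [coordBracket, funext_iff, Fin.forall_fin_succ]
      grind
  · refine .inr (.inr (.inl (isN56_iff.2 (H.change ![![1, 0, 0, 0, 0], ![0, 1, 0, 0, 0],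
      ![q / c, -p / c, 1, 0, 0],
      (c / (m + (h * q - k * p) / c)) • ![k / c, -h / c, 0, 1, 0], ![0, 0, 0, 0, c]] ?_ _ _ _ _ _ _ _ _ _ _ ?_))))
    · simp [Matrix.det_succ_row_zero, Fin.sum_univ_succ, Fin.succAbove, hc, hr]
    · simp [coordBracket, funext_iff, Fin.forall_fin_succ]
      grind

/-- Every non-abelian nilpotent Lie algebra of dimension five is one of the eight. -/
theorem isListed_of_finrank_eq [LieRing.IsNilpotent 𝔤] (h5 : Module.finrank ℝ 𝔤 = 5)
    (hab : ¬ IsLieAbelian 𝔤) : IsListed 𝔤 := by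
  obtain ⟨e, he⟩ := exists_isNilpotentFrame h5
  obtain ⟨a, b, c, d, p, f, q, h, k, m, H⟩ := he.exists_hasBrackets
  by_cases ha : a = 0
  swap; · exact H.isListed_of_ne_zero ha
  subst ha
  by_cases hb : b = 0
  swap; · exact H.isListed_of_ne_zero_right hb
  subst hb
  by_cases hd : d = 0
  swap
  -- From here on, permutations of the basis move the first non-zero structure constant into the
  -- bracket of the first two vectors, where an earlier case applies.
  · obtain ⟨e', H⟩ := H.change
      ![![1, 0, 0, 0, 0], ![0, 0, 1, 0, 0], ![0, 1, 0, 0, 0], ![0, 0, 0, 1, 0], ![0, 0, 0, 0, 1]]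
      (by simp [Matrix.det_succ_row_zero, Fin.sum_univ_succ, Fin.succAbove])
      0 d p 0 c (-f) (-q) h m k
      (by simp [coordBracket, funext_iff, Fin.forall_fin_succ])
    exact H.isListed_of_ne_zero_right hd
  subst hd
  by_cases hf : f = 0
  swap
  · obtain ⟨e', H⟩ := H.change
      ![![0, 1, 0, 0, 0], ![0, 0, 1, 0, 0], ![1, 0, 0, 0, 0], ![0, 0, 0, 1, 0], ![0, 0, 0, 0, 1]]
      (by simp [Matrix.det_succ_row_zero, Fin.sum_univ_succ, Fin.succAbove])
      0 f q 0 (-c) 0 (-p) k m h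
      (by simp [coordBracket, funext_iff, Fin.forall_fin_succ])
    exact H.isListed_of_ne_zero_right hf
  subst hf
  by_cases hc : c = 0
  swap; · exact H.isListed_of_form hc
  subst hc
  by_cases hp : p = 0
  swap
  · obtain ⟨e', H⟩ := H.change
      ![![1, 0, 0, 0, 0], ![0, 0, 1, 0, 0], ![0, 1, 0, 0, 0], ![0, 0, 0, 1, 0], ![0, 0, 0, 0, 1]]
      (by simp [Matrix.det_succ_row_zero, Fin.sum_univ_succ, Fin.succAbove])
      0 0 p 0 0 0 (-q) h m k
      (by simp [coordBracket, funext_iff, Fin.forall_fin_succ])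
    exact H.isListed_of_form hp
  subst hp
  by_cases hq : q = 0
  swap
  · obtain ⟨e', H⟩ := H.change
      ![![0, 1, 0, 0, 0], ![0, 0, 1, 0, 0], ![1, 0, 0, 0, 0], ![0, 0, 0, 1, 0], ![0, 0, 0, 0, 1]]
      (by simp [Matrix.det_succ_row_zero, Fin.sum_univ_succ, Fin.succAbove])
      0 0 q 0 0 0 0 k m h
      (by simp [coordBracket, funext_iff, Fin.forall_fin_succ])
    exact H.isListed_of_form hq
  subst hq
  by_cases hh : h = 0
  swap
  · obtain ⟨e', H⟩ := H.change
      ![![1, 0, 0, 0, 0], ![0, 0, 0, 1, 0], ![0, 0, 1, 0, 0], ![0, 1, 0, 0, 0], ![0, 0, 0, 0, 1]]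
      (by simp [Matrix.det_succ_row_zero, Fin.sum_univ_succ, Fin.succAbove])
      0 0 h 0 0 0 (-m) 0 (-k) 0
      (by simp [coordBracket, funext_iff, Fin.forall_fin_succ])
    exact H.isListed_of_form hh
  subst hh
  by_cases hk : k = 0
  swap
  · obtain ⟨e', H⟩ := H.change
      ![![0, 1, 0, 0, 0], ![0, 0, 0, 1, 0], ![1, 0, 0, 0, 0], ![0, 0, 1, 0, 0], ![0, 0, 0, 0, 1]]
      (by simp [Matrix.det_succ_row_zero, Fin.sum_univ_succ, Fin.succAbove])
      0 0 k 0 0 0 0 0 (-m) 0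
      (by simp [coordBracket, funext_iff, Fin.forall_fin_succ])
    exact H.isListed_of_form hk
  subst hk
  by_cases hm : m = 0
  swap
  · obtain ⟨e', H⟩ := H.change
      ![![0, 0, 1, 0, 0], ![0, 0, 0, 1, 0], ![1, 0, 0, 0, 0], ![0, 1, 0, 0, 0], ![0, 0, 0, 0, 1]]
      (by simp [Matrix.det_succ_row_zero, Fin.sum_univ_succ, Fin.succAbove])
      0 0 m 0 0 0 0 0 0 0
      (by simp [coordBracket, funext_iff, Fin.forall_fin_succ])
    exact H.isListed_of_form hm
  subst hm
  refine absurd ⟨fun X Y => ?_⟩ hab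
  rw [← e.sum_repr X, ← e.sum_repr Y, H.lie_sum]
  simp [coordBracket, Fin.sum_univ_succ]

end Classification

section NormalForms

variable {𝔤 : Type*} [LieRing 𝔤] [LieAlgebra ℝ 𝔤] {g : LeftInvariantMetric 𝔤}

/-! ### Orthonormal bases adapted to a flag -/

namespace LeftInvariantMetric

theorem exists_isOrthonormal_of_inner (g : LeftInvariantMetric 𝔤) (b : Module.Basis (Fin 5) ℝ 𝔤)
    (v : Fin 5 → 𝔤) (hv : ∀ i j, g.inner (v i) (v j) = if i = j then 1 else 0) :
    ∃ e : Module.Basis (Fin 5) ℝ 𝔤, g.IsOrthonormal e ∧ ∀ i, e i = v i := by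
  have hli : LinearIndependent ℝ v := by
    rw [Fintype.linearIndependent_iff]
    intro c hc i
    have := congrArg (fun X => g.inner X (v i)) hc
    simpa [hv] using this
  have hcard : Fintype.card (Fin 5) = Module.finrank ℝ 𝔤 := (Module.finrank_eq_card_basis b).symm
  refine ⟨basisOfLinearIndependentOfCardEqFinrank hli hcard, fun i j => ?_, fun i => ?_⟩
  · simp [hv]
  · simp

theorem IsOrthonormal.rotate {e : Module.Basis (Fin 5) ℝ 𝔤} (he : g.IsOrthonormal e)
    (P : Fin 5 → Fin 5 → ℝ) (hP : ∀ i j, i ≤ j → ∑ k, P i k * P j k = if i = j then 1 else 0) :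
    ∃ e' : Module.Basis (Fin 5) ℝ 𝔤, g.IsOrthonormal e' ∧ ∀ i, e' i = ∑ j, P i j • e j := by
  refine g.exists_isOrthonormal_of_inner e _ fun i j => ?_
  have h : g.inner (∑ k, P i k • e k) (∑ k, P j k • e k) = ∑ k, P i k * P j k := by
    simp [he _ _, mul_comm]
  rw [h]
  rcases le_total i j with hij | hij
  · exact hP i j hij
  · simp only [mul_comm (P i _), hP j i hij, eq_comm]

/-- Gram-Schmidt orthonormalization, starting from the last vector. -/
theorem exists_isOrthonormal_flag (g : LeftInvariantMetric 𝔤) (b : Module.Basis (Fin 5) ℝ 𝔤) :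
    ∃ e : Module.Basis (Fin 5) ℝ 𝔤, g.IsOrthonormal e ∧ (∀ i j, j < i → b.repr (e i) j = 0) ∧
      ∀ i j, j < i → g.inner (b i) (e j) = 0 := by
  let core : InnerProductSpace.Core ℝ 𝔤 :=
    { inner := fun X Y => g.inner X Y
      conj_inner_symm := fun X Y => g.symm Y X
      re_inner_nonneg := fun X => by
        by_cases h : X = 0
        · simp [h]
        · exact (g.pos X h).le
      add_left := fun X Y Z => by simp
      smul_left := fun X Y r => by simp
      definite := fun X h => by
        by_contra h0
        exact (g.pos X h0).ne' h }
  let : NormedAddCommGroup 𝔤 := core.toNormedAddCommGroup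
  let : InnerProductSpace ℝ 𝔤 := InnerProductSpace.ofCore core.toCore
  have hinner (X Y : 𝔤) : Inner.inner ℝ X Y = g.inner X Y := rfl
  set c := b.reindex Fin.revPerm with hc
  have hcb (i) : c i = b i.rev := by simp [c]
  have hortho := InnerProductSpace.gramSchmidtNormed_orthonormal (𝕜 := ℝ) c.linearIndependent
  obtain ⟨e, he, hev⟩ := g.exists_isOrthonormal_of_inner b
    (fun i => InnerProductSpace.gramSchmidtNormed ℝ c i.rev) (fun i j => by
      rw [← hinner, orthonormal_iff_ite.1 hortho]
      simp)
  refine ⟨e, he, fun i j hij => ?_, fun i j hij => ?_⟩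
  · have h1 : b.repr (e i) j = c.repr (e i) j.rev := by simp [c]
    rw [h1, hev, InnerProductSpace.gramSchmidtNormed, map_smul, Finsupp.smul_apply,
      InnerProductSpace.gramSchmidt_triangular (Fin.rev_lt_rev.2 hij), smul_zero]
  · have h1 := InnerProductSpace.gramSchmidt_inv_triangular ℝ c (Fin.rev_lt_rev.2 hij)
    rw [hcb, Fin.rev_rev, hinner, g.symm] at h1
    rw [hev, InnerProductSpace.gramSchmidtNormed, map_smul, h1, smul_zero]

end LeftInvariantMetric

/-- The brackets in an orthonormal basis adapted to the flag of a given basis. -/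
theorem HasBrackets.exists_adapted {b : Module.Basis (Fin 5) ℝ 𝔤} {a β c d p f q h k m : ℝ}
    (H : HasBrackets b a β c d p f q h k m) (g : LeftInvariantMetric 𝔤) :
    ∃ (e : Module.Basis (Fin 5) ℝ 𝔤) (P Q : Fin 5 → Fin 5 → ℝ), g.IsOrthonormal e ∧
      (∀ i, e i = ∑ j, P i j • b j) ∧ (∀ i, b i = ∑ j, Q i j • e j) ∧
      (∀ i j, j < i → P i j = 0) ∧ (∀ i j, j < i → Q i j = 0) ∧ (∀ i, P i i ≠ 0) ∧
      (∀ i, Q i i ≠ 0) ∧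
      let C := fun i j => coordBracket a β c d p f q h k m (P i) (P j)
      HasBrackets e (C 0 1 2 * Q 2 2) (C 0 1 2 * Q 2 3 + C 0 1 3 * Q 3 3)
        (C 0 1 2 * Q 2 4 + C 0 1 3 * Q 3 4 + C 0 1 4 * Q 4 4)
        (C 0 2 3 * Q 3 3) (C 0 2 3 * Q 3 4 + C 0 2 4 * Q 4 4)
        (C 1 2 3 * Q 3 3) (C 1 2 3 * Q 3 4 + C 1 2 4 * Q 4 4)
        (C 0 3 4 * Q 4 4) (C 1 3 4 * Q 4 4) (C 2 3 4 * Q 4 4) := by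
  obtain ⟨e, he, hP, hQ⟩ := g.exists_isOrthonormal_flag b
  have heb (i) : e i = ∑ j, b.repr (e i) j • b j := (b.sum_repr _).symm
  have hbe (i) : b i = ∑ j, g.inner (b i) (e j) • e j := (he.sum_inner_smul _).symm
  -- The two triangular matrices are inverse to each other, so corresponding diagonal entries are
  -- reciprocal. Their being non-zero is what later makes the `μ`'s non-zero.
  have hPQ (i) : b.repr (e i) i * g.inner (b i) (e i) = 1 := by
    have h1 : g.inner (e i) (e i) = 1 := by simp [he i i]
    conv at h1 => lhs; arg 1; rw [heb i]
    rw [← h1, map_sum, LinearMap.sum_apply, Finset.sum_eq_single i]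
    · simp
    · intro j _ hj
      rcases lt_or_gt_of_ne hj with hj | hj
      · simp [hP i j hj]
      · simp [hQ j i hj]
    · simp
  refine ⟨e, fun i j => b.repr (e i) j, fun i j => g.inner (b i) (e j), he, heb, hbe, hP, hQ,
    fun i => left_ne_zero_of_mul_eq_one (hPQ i), fun i => right_ne_zero_of_mul_eq_one (hPQ i), ?_⟩
  intro C
  have hlie (i j) : ⁅e i, e j⁆ = C i j 2 • b 2 + C i j 3 • b 3 + C i j 4 • b 4 := by
    rw [heb i, heb j, H.lie_sum, Fin.sum_univ_five]
    have h0 : C i j 0 = 0 := rfl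
    have h1 : C i j 1 = 0 := rfl
    change C i j 0 • b 0 + C i j 1 • b 1 + C i j 2 • b 2 + C i j 3 • b 3 + C i j 4 • b 4 = _
    rw [h0, h1]
    module
  have hb2 := hbe 2
  have hb3 := hbe 3
  have hb4 := hbe 4
  simp (disch := decide) only [Fin.sum_univ_five, hQ, zero_smul, zero_add] at hb2 hb3 hb4
  have z022 : C 0 2 2 = 0 := by simp (disch := decide) [C, coordBracket, hP]
  have z032 : C 0 3 2 = 0 := by simp (disch := decide) [C, coordBracket, hP]
  have z033 : C 0 3 3 = 0 := by simp (disch := decide) [C, coordBracket, hP]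
  have z042 : C 0 4 2 = 0 := by simp (disch := decide) [C, coordBracket, hP]
  have z043 : C 0 4 3 = 0 := by simp (disch := decide) [C, coordBracket, hP]
  have z044 : C 0 4 4 = 0 := by simp (disch := decide) [C, coordBracket, hP]
  have z122 : C 1 2 2 = 0 := by simp (disch := decide) [C, coordBracket, hP]
  have z132 : C 1 3 2 = 0 := by simp (disch := decide) [C, coordBracket, hP]
  have z133 : C 1 3 3 = 0 := by simp (disch := decide) [C, coordBracket, hP]
  have z142 : C 1 4 2 = 0 := by simp (disch := decide) [C, coordBracket, hP]
  have z143 : C 1 4 3 = 0 := by simp (disch := decide) [C, coordBracket, hP]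
  have z144 : C 1 4 4 = 0 := by simp (disch := decide) [C, coordBracket, hP]
  have z2 (i j : Fin 5) (hi : 1 < i) (hj : 1 < j) : C i j 2 = 0 := by
    simp [C, coordBracket, hP i 0 (by omega), hP i 1 hi, hP j 0 (by omega), hP j 1 hj]
  have z3 (i j : Fin 5) (hi : 1 < i) (hj : 1 < j) : C i j 3 = 0 := by
    simp [C, coordBracket, hP i 0 (by omega), hP i 1 hi, hP j 0 (by omega), hP j 1 hj]
  have z4 (i : Fin 5) (hi : 1 < i) : C i 4 4 = 0 := by
    simp (disch := decide) [C, coordBracket, hP i 0 (by omega), hP i 1 hi, hP 4]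
  refine ⟨?_, ?_, ?_, ?_, ?_, ?_, ?_, ?_, ?_, ?_⟩ <;> rw [hlie]
  · rw [hb2, hb3, hb4]; module
  · rw [z022, hb3, hb4]; module
  · rw [z032, z033, hb4]; module
  · rw [z042, z043, z044]; module
  · rw [z122, hb3, hb4]; module
  · rw [z132, z133, hb4]; module
  · rw [z142, z143, z144]; module
  · rw [z2 2 3 (by decide) (by decide), z3 2 3 (by decide) (by decide), hb4]; module
  · rw [z2 2 4 (by decide) (by decide), z3 2 4 (by decide) (by decide), z4 2 (by decide)]; module
  · rw [z2 3 4 (by decide) (by decide), z3 3 4 (by decide) (by decide), z4 3 (by decide)]; module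

end NormalForms

section NormalForms

variable {𝔤 : Type*} [LieRing 𝔤] [LieAlgebra ℝ 𝔤] {g : LeftInvariantMetric 𝔤}

/-! ### Orthonormal normal forms -/

section

variable {e : Module.Basis (Fin 5) ℝ 𝔤}

/-- The basis is fixed in this and the next seven statements, so the sign of `d` cannot be absorbed
and the brackets carry `-μ` and `-λ`. -/
theorem formL3A2_iff {μ₁₂ : ℝ} : FormL3A2 e μ₁₂ ↔
    μ₁₂ ≠ 0 ∧ HasBrackets e 0 0 (-μ₁₂) 0 0 0 0 0 0 0 := by
  rw [FormL3A2, structureEqs_iff _ _ _ _ (by simp [transpose_wedge, add_comm, add_assoc])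
    (by simp [transpose_wedge, add_comm, add_assoc])
    (by simp [transpose_wedge, add_comm, add_assoc])]
  simp [Fin.forall_fin_succ, wedge_apply, HasBrackets, and_assoc, -neg_add_rev, neg_add]

theorem formL4A1_iff {μ₁₂ l₁₂ l₁₃ μ₁₄ : ℝ} : FormL4A1 e μ₁₂ l₁₂ l₁₃ μ₁₄ ↔
    μ₁₂ ≠ 0 ∧ μ₁₄ ≠ 0 ∧ HasBrackets e 0 (-μ₁₂) (-l₁₂) 0 (-l₁₃) 0 0 (-μ₁₄) 0 0 := by
  rw [FormL4A1, structureEqs_iff _ _ _ _ (by simp [transpose_wedge, add_comm, add_assoc])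
    (by simp [transpose_wedge, add_comm, add_assoc])
    (by simp [transpose_wedge, add_comm, add_assoc])]
  simp [Fin.forall_fin_succ, wedge_apply, HasBrackets, and_assoc, -neg_add_rev, neg_add]

theorem formN56_iff {μ₁₂ μ₃₄ : ℝ} : FormN56 e μ₁₂ μ₃₄ ↔
    μ₁₂ ≠ 0 ∧ μ₃₄ ≠ 0 ∧ HasBrackets e 0 0 (-μ₁₂) 0 0 0 0 0 0 (-μ₃₄) := by
  rw [FormN56, structureEqs_iff _ _ _ _ (by simp [transpose_wedge, add_comm, add_assoc])
    (by simp [transpose_wedge, add_comm, add_assoc])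
    (by simp [transpose_wedge, add_comm, add_assoc])]
  simp [Fin.forall_fin_succ, wedge_apply, HasBrackets, and_assoc, -neg_add_rev, neg_add]

theorem formN55_iff {μ₁₂ μ₁₃ : ℝ} : FormN55 e μ₁₂ μ₁₃ ↔
    μ₁₂ ≠ 0 ∧ μ₁₃ ≠ 0 ∧ HasBrackets e 0 (-μ₁₂) 0 0 (-μ₁₃) 0 0 0 0 0 := by
  rw [FormN55, structureEqs_iff _ _ _ _ (by simp [transpose_wedge, add_comm, add_assoc])
    (by simp [transpose_wedge, add_comm, add_assoc])
    (by simp [transpose_wedge, add_comm, add_assoc])]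
  simp [Fin.forall_fin_succ, wedge_apply, HasBrackets, and_assoc, -neg_add_rev, neg_add]

theorem formN54_iff {μ₁₂ l₁₂ l₁₃ μ₁₄ μ₂₃ : ℝ} : FormN54 e μ₁₂ l₁₂ l₁₃ μ₁₄ μ₂₃ ↔
    μ₁₂ ≠ 0 ∧ μ₁₄ ≠ 0 ∧ μ₂₃ ≠ 0 ∧ HasBrackets e 0 (-μ₁₂) (-l₁₂) 0 (-l₁₃) 0 (-μ₂₃) (-μ₁₄) 0 0 := by
  rw [FormN54, structureEqs_iff _ _ _ _ (by simp [transpose_wedge, add_comm, add_assoc])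
    (by simp [transpose_wedge, add_comm, add_assoc])
    (by simp [transpose_wedge, add_comm, add_assoc])]
  simp [Fin.forall_fin_succ, wedge_apply, HasBrackets, and_assoc, -neg_add_rev, neg_add]

theorem formN53_iff {μ₁₂ l₄ μ₁₃ l₅ μ₂₃ : ℝ} : FormN53 e μ₁₂ l₄ μ₁₃ l₅ μ₂₃ ↔
    μ₁₂ ≠ 0 ∧ μ₁₃ ≠ 0 ∧ μ₂₃ ≠ 0 ∧ HasBrackets e (-μ₁₂) (-l₄) (-l₅) (-μ₁₃) 0 0 (-μ₂₃) 0 0 0 := by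
  rw [FormN53, structureEqs_iff _ _ _ _ (by simp [transpose_wedge, add_comm, add_assoc])
    (by simp [transpose_wedge, add_comm, add_assoc])
    (by simp [transpose_wedge, add_comm, add_assoc])]
  simp [Fin.forall_fin_succ, wedge_apply, HasBrackets, and_assoc, -neg_add_rev, neg_add]

theorem formN52_iff {μ₁₂ l₄ μ₁₃ l₅ l₁₃ μ₁₄ : ℝ} : FormN52 e μ₁₂ l₄ μ₁₃ l₅ l₁₃ μ₁₄ ↔
    μ₁₂ ≠ 0 ∧ μ₁₃ ≠ 0 ∧ μ₁₄ ≠ 0 ∧ HasBrackets e (-μ₁₂) (-l₄) (-l₅) (-μ₁₃) (-l₁₃) 0 0 (-μ₁₄) 0 0 := by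
  rw [FormN52, structureEqs_iff _ _ _ _ (by simp [transpose_wedge, add_comm, add_assoc])
    (by simp [transpose_wedge, add_comm, add_assoc])
    (by simp [transpose_wedge, add_comm, add_assoc])]
  simp [Fin.forall_fin_succ, wedge_apply, HasBrackets, and_assoc, -neg_add_rev, neg_add]

theorem formN51_iff {μ₁₂ l₄ μ₁₃ l₅ l₁₃ μ₁₄ μ₂₃ : ℝ} : FormN51 e μ₁₂ l₄ μ₁₃ l₅ l₁₃ μ₁₄ μ₂₃ ↔
    μ₁₂ ≠ 0 ∧ μ₁₃ ≠ 0 ∧ μ₁₄ ≠ 0 ∧ μ₂₃ ≠ 0 ∧ HasBrackets e (-μ₁₂) (-l₄) (-l₅) (-μ₁₃) (-l₁₃) 0 (-μ₂₃) (-μ₁₄) 0 0 := by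
  rw [FormN51, structureEqs_iff _ _ _ _ (by simp [transpose_wedge, add_comm, add_assoc])
    (by simp [transpose_wedge, add_comm, add_assoc])
    (by simp [transpose_wedge, add_comm, add_assoc])]
  simp [Fin.forall_fin_succ, wedge_apply, HasBrackets, and_assoc, -neg_add_rev, neg_add]

end

/-! ### Normal forms obtained from the flag alone -/

theorem HasBrackets.formL3A2 {e : Module.Basis (Fin 5) ℝ 𝔤} {c : ℝ}
    (H : HasBrackets e 0 0 c 0 0 0 0 0 0 0) (hc : c ≠ 0) :
    FormL3A2 e (-c) :=
  formL3A2_iff.2 ⟨neg_ne_zero.2 hc, by simpa only [neg_neg] using H⟩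

/-- As also for `L_4 ⊕ A_1`, `N_{5,4}`, `N_{5,2}` and `N_{5,1}`: triangularity leaves only the terms
allowed in the normal form, and each `μ` is, up to sign, a product of diagonal entries of `P` and
`Q`. -/
theorem IsL3A2.exists_form (h𝔤 : IsL3A2 𝔤) (g : LeftInvariantMetric 𝔤) :
    ∃ e, g.IsOrthonormal e ∧ ∃ μ₁₂, FormL3A2 e μ₁₂ := by
  obtain ⟨b, H⟩ := isL3A2_iff.1 h𝔤
  obtain ⟨e, P, Q, he, -, -, hP, hQ, hP0, hQ0, H⟩ := H.exists_adapted g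
  simp (disch := decide) [coordBracket, hP] at H
  exact ⟨e, he, _, H.formL3A2 (by simp [hP0, hQ0])⟩

theorem HasBrackets.formL4A1 {e : Module.Basis (Fin 5) ℝ 𝔤} {b c p h : ℝ}
    (H : HasBrackets e 0 b c 0 p 0 0 h 0 0) (hb : b ≠ 0) (hh : h ≠ 0) :
    FormL4A1 e (-b) (-c) (-p) (-h) :=
  formL4A1_iff.2 ⟨neg_ne_zero.2 hb, neg_ne_zero.2 hh, by simpa only [neg_neg] using H⟩

theorem IsL4A1.exists_form (h𝔤 : IsL4A1 𝔤) (g : LeftInvariantMetric 𝔤) :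
    ∃ e, g.IsOrthonormal e ∧ ∃ μ₁₂ l₁₂ l₁₃ μ₁₄, FormL4A1 e μ₁₂ l₁₂ l₁₃ μ₁₄ := by
  obtain ⟨b, H⟩ := isL4A1_iff.1 h𝔤
  obtain ⟨e, P, Q, he, -, -, hP, hQ, hP0, hQ0, H⟩ := H.exists_adapted g
  simp (disch := decide) [coordBracket, hP] at H
  exact ⟨e, he, _, _, _, _, H.formL4A1 (by simp [hP0, hQ0]) (by simp [hP0, hQ0])⟩

theorem HasBrackets.formN54 {e : Module.Basis (Fin 5) ℝ 𝔤} {b c p q h : ℝ}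
    (H : HasBrackets e 0 b c 0 p 0 q h 0 0) (hb : b ≠ 0) (hh : h ≠ 0) (hq : q ≠ 0) :
    FormN54 e (-b) (-c) (-p) (-h) (-q) :=
  formN54_iff.2 ⟨neg_ne_zero.2 hb, neg_ne_zero.2 hh, neg_ne_zero.2 hq, by simpa only [neg_neg] using H⟩

theorem IsN54.exists_form (h𝔤 : IsN54 𝔤) (g : LeftInvariantMetric 𝔤) :
    ∃ e, g.IsOrthonormal e ∧ ∃ μ₁₂ l₁₂ l₁₃ μ₁₄ μ₂₃, FormN54 e μ₁₂ l₁₂ l₁₃ μ₁₄ μ₂₃ := by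
  obtain ⟨b, H⟩ := isN54_iff.1 h𝔤
  obtain ⟨e, P, Q, he, -, -, hP, hQ, hP0, hQ0, H⟩ := H.exists_adapted g
  simp (disch := decide) [coordBracket, hP] at H
  exact ⟨e, he, _, _, _, _, _, H.formN54 (by simp [hP0, hQ0]) (by simp [hP0, hQ0]) (by simp [hP0, hQ0])⟩

theorem HasBrackets.formN52 {e : Module.Basis (Fin 5) ℝ 𝔤} {a b c d p h : ℝ}
    (H : HasBrackets e a b c d p 0 0 h 0 0) (ha : a ≠ 0) (hd : d ≠ 0) (hh : h ≠ 0) :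
    FormN52 e (-a) (-b) (-d) (-c) (-p) (-h) :=
  formN52_iff.2 ⟨neg_ne_zero.2 ha, neg_ne_zero.2 hd, neg_ne_zero.2 hh, by simpa only [neg_neg] using H⟩

theorem IsN52.exists_form (h𝔤 : IsN52 𝔤) (g : LeftInvariantMetric 𝔤) :
    ∃ e, g.IsOrthonormal e ∧ ∃ μ₁₂ l₄ μ₁₃ l₅ l₁₃ μ₁₄, FormN52 e μ₁₂ l₄ μ₁₃ l₅ l₁₃ μ₁₄ := by
  obtain ⟨b, H⟩ := isN52_iff.1 h𝔤
  obtain ⟨e, P, Q, he, -, -, hP, hQ, hP0, hQ0, H⟩ := H.exists_adapted g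
  simp (disch := decide) [coordBracket, hP] at H
  exact ⟨e, he, _, _, _, _, _, _, H.formN52 (by simp [hP0, hQ0]) (by simp [hP0, hQ0]) (by simp [hP0, hQ0])⟩

theorem HasBrackets.formN51 {e : Module.Basis (Fin 5) ℝ 𝔤} {a b c d p q h : ℝ}
    (H : HasBrackets e a b c d p 0 q h 0 0) (ha : a ≠ 0) (hd : d ≠ 0) (hh : h ≠ 0) (hq : q ≠ 0) :
    FormN51 e (-a) (-b) (-d) (-c) (-p) (-h) (-q) :=
  formN51_iff.2 ⟨neg_ne_zero.2 ha, neg_ne_zero.2 hd, neg_ne_zero.2 hh, neg_ne_zero.2 hq, by simpa only [neg_neg] using H⟩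

theorem IsN51.exists_form (h𝔤 : IsN51 𝔤) (g : LeftInvariantMetric 𝔤) :
    ∃ e, g.IsOrthonormal e ∧ ∃ μ₁₂ l₄ μ₁₃ l₅ l₁₃ μ₁₄ μ₂₃, FormN51 e μ₁₂ l₄ μ₁₃ l₅ l₁₃ μ₁₄ μ₂₃ := by
  obtain ⟨b, H⟩ := isN51_iff.1 h𝔤
  obtain ⟨e, P, Q, he, -, -, hP, hQ, hP0, hQ0, H⟩ := H.exists_adapted g
  simp (disch := decide) [coordBracket, hP] at H
  exact ⟨e, he, _, _, _, _, _, _, _, H.formN51 (by simp [hP0, hQ0]) (by simp [hP0, hQ0]) (by simp [hP0, hQ0]) (by simp [hP0, hQ0])⟩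

/-! ### Normal forms that need a further rotation -/

/-- The angle that diagonalizes a symmetric form in two variables. -/
theorem exists_rotation (α β : ℝ) :
    ∃ C S : ℝ, C ^ 2 + S ^ 2 = 1 ∧ C * S * α + (C ^ 2 - S ^ 2) * β = 0 := by
  -- In the double angle the condition reads `(α/2) sin 2θ + β cos 2θ = 0`, so `2θ` may be the
  -- argument of `α/2 - iβ`.
  set z : ℂ := ⟨α / 2, -β⟩
  set θ := z.arg / 2
  have hθ : z.arg = 2 * θ := by ring
  refine ⟨Real.cos θ, Real.sin θ, Real.cos_sq_add_sin_sq θ, ?_⟩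
  have hc : ‖z‖ * Real.cos (2 * θ) = α / 2 := by rw [← hθ, Complex.norm_mul_cos_arg]
  have hs : ‖z‖ * Real.sin (2 * θ) = -β := by rw [← hθ, Complex.norm_mul_sin_arg]
  have hα : α = 2 * (‖z‖ * Real.cos (2 * θ)) := by rw [hc]; ring
  have hβ : β = -(‖z‖ * Real.sin (2 * θ)) := by rw [hs]; ring
  have h2 : Real.cos θ ^ 2 - Real.sin θ ^ 2 = Real.cos (2 * θ) := (Real.cos_two_mul' θ).symm
  rw [h2]
  conv_lhs => rw [hα, hβ, Real.sin_two_mul]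
  ring

/-- Singular value decomposition of a lower triangular `2 × 2` matrix: the images of the rotated
basis vectors are `r (u, v)` and `s (-v, u)`. -/
theorem exists_rotation_orthogonal {x y z : ℝ} (hx : x ≠ 0) (hz : z ≠ 0) :
    ∃ C S u v r s : ℝ, C ^ 2 + S ^ 2 = 1 ∧ u ^ 2 + v ^ 2 = 1 ∧ r ≠ 0 ∧ s ≠ 0 ∧
      C * x = r * u ∧ C * y + S * z = r * v ∧ -S * x = -s * v ∧ -S * y + C * z = s * u := by
  -- These parameters express orthogonality of the images `(A,B)` and `(D,E)` of the rotated basis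
  -- vectors.
  obtain ⟨C, S, hCS, h⟩ := exists_rotation (z ^ 2 - x ^ 2 - y ^ 2) (y * z)
  set A := C * x with hA
  set B := C * y + S * z with hB
  have hdet : A * (-S * y + C * z) - B * (-S * x) = x * z := by
    rw [hA, hB]; linear_combination x * z * hCS
  have hort : A * (-S * x) + B * (-S * y + C * z) = 0 := by
    rw [hA, hB]; linear_combination h
  set D := -S * x
  set E := -S * y + C * z
  have hpos : 0 < A ^ 2 + B ^ 2 := by
    rcases eq_or_ne A 0 with h0 | h0
    · have : B ≠ 0 := by
        rintro h1
        rw [h0, h1] at hdet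
        simp [eq_comm, hx, hz] at hdet
      positivity
    · positivity
  set r := Real.sqrt (A ^ 2 + B ^ 2)
  have hr : r ^ 2 = A ^ 2 + B ^ 2 := Real.sq_sqrt hpos.le
  have hr0 : r ≠ 0 := (Real.sqrt_pos.2 hpos).ne'
  -- The second singular value is `xz/r` because a rotation preserves the determinant `xz = rs`.
  refine ⟨C, S, A / r, B / r, r, x * z / r, hCS, ?_, hr0, by positivity, ?_, ?_, ?_, ?_⟩
  · field_simp; exact hr.symm
  · rw [← hA]; field_simp
  · rw [← hB]; field_simp
  · change D = _
    rw [← hdet]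
    clear_value A B D E r
    field_simp
    rw [hr]
    linear_combination A * hort
  · change E = _
    rw [← hdet]
    clear_value A B D E r
    field_simp
    rw [hr]
    linear_combination B * hort

/-- In the adapted basis `ad e_1` maps `⟨e_2, e_3⟩` to `⟨e_4, e_5⟩` by an invertible triangular
matrix; rotating both planes by its singular value decomposition makes it diagonal. -/
theorem IsN55.exists_form (h𝔤 : IsN55 𝔤) (g : LeftInvariantMetric 𝔤) :
    ∃ e, g.IsOrthonormal e ∧ ∃ μ₁₂ μ₁₃, FormN55 e μ₁₂ μ₁₃ := by
  obtain ⟨b, H⟩ := isN55_iff.1 h𝔤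
  obtain ⟨e, P, Q, he, -, -, hP, hQ, hP0, hQ0, H⟩ := H.exists_adapted g
  simp (disch := decide) [coordBracket, hP] at H
  have hx : P 0 0 * P 1 1 * Q 3 3 ≠ 0 := by simp [hP0, hQ0]
  have hz : P 0 0 * P 2 2 * Q 4 4 ≠ 0 := by simp [hP0, hQ0]
  generalize P 0 0 * P 1 1 * Q 3 3 = x at H hx
  generalize P 0 0 * P 2 2 * Q 4 4 = z at H hz
  generalize P 0 0 * P 1 1 * Q 3 4 + P 0 0 * P 1 2 * Q 4 4 = y at H
  obtain ⟨C, S, u, v, r, s, hCS, huv, hr, hs, h1, h2, h3, h4⟩ :=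
    exists_rotation_orthogonal (y := y) hx hz
  set R : Fin 5 → Fin 5 → ℝ := ![![1, 0, 0, 0, 0], ![0, C, S, 0, 0], ![0, -S, C, 0, 0],
    ![0, 0, 0, u, v], ![0, 0, 0, -v, u]]
  obtain ⟨e', he', hv⟩ := he.rotate R (by
    simp [R, Fin.forall_fin_succ, Fin.sum_univ_succ]; grind)
  refine ⟨e', he', -r, -s, formN55_iff.2 ⟨by simpa, by simpa, H.of_coords R hv _ _ _ _ _ _ _ _ _ _ ?_⟩⟩
  clear H
  simp [R, coordBracket, funext_iff, Fin.forall_fin_succ]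
  grind

/-- The map to be diagonalized is `[·, e_3]` from `⟨e_1, e_2⟩` to `⟨e_4, e_5⟩`. Rotating the source
leaves `[e_1, e_2]` unchanged, so its components in `⟨e_4, e_5⟩` are merely rotated and stay
arbitrary. -/
theorem IsN53.exists_form (h𝔤 : IsN53 𝔤) (g : LeftInvariantMetric 𝔤) :
    ∃ e, g.IsOrthonormal e ∧ ∃ μ₁₂ l₄ μ₁₃ l₅ μ₂₃, FormN53 e μ₁₂ l₄ μ₁₃ l₅ μ₂₃ := by
  obtain ⟨b, H⟩ := isN53_iff.1 h𝔤
  obtain ⟨e, P, Q, he, -, -, hP, hQ, hP0, hQ0, H⟩ := H.exists_adapted g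
  simp (disch := decide) [coordBracket, hP] at H
  have hw : P 0 0 * P 1 1 * Q 2 2 ≠ 0 := by simp [hP0, hQ0]
  have hx : P 0 0 * P 2 2 * Q 3 3 ≠ 0 := by simp [hP0, hQ0]
  have hz : P 1 1 * P 2 2 * Q 4 4 ≠ 0 := by simp [hP0, hQ0]
  generalize P 0 0 * P 1 1 * Q 2 2 = w at H hw
  generalize P 0 0 * P 2 2 * Q 3 3 = x at H hx
  generalize P 1 1 * P 2 2 * Q 4 4 = z at H hz
  generalize P 0 0 * P 1 1 * Q 2 3 + P 0 0 * P 1 2 * Q 3 3 = b' at H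
  generalize P 0 0 * P 1 1 * Q 2 4 + P 0 0 * P 1 2 * Q 3 4 +
    (P 0 1 * P 1 2 - P 0 2 * P 1 1) * Q 4 4 = c' at H
  generalize P 0 0 * P 2 2 * Q 3 4 + P 0 1 * P 2 2 * Q 4 4 = y at H
  obtain ⟨C, S, u, v, r, s, hCS, huv, hr, hs, h1, h2, h3, h4⟩ :=
    exists_rotation_orthogonal (y := y) hx hz
  set R : Fin 5 → Fin 5 → ℝ := ![![C, S, 0, 0, 0], ![-S, C, 0, 0, 0], ![0, 0, 1, 0, 0],
    ![0, 0, 0, u, v], ![0, 0, 0, -v, u]]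
  obtain ⟨e', he', hv⟩ := he.rotate R (by
    simp [R, Fin.forall_fin_succ, Fin.sum_univ_succ]; grind)
  refine ⟨e', he', -w, -(b' * u + c' * v), -r, -(-b' * v + c' * u), -s, formN53_iff.2
    ⟨by simpa, by simpa, by simpa, H.of_coords R hv _ _ _ _ _ _ _ _ _ _ ?_⟩⟩
  clear H
  simp [R, coordBracket, funext_iff, Fin.forall_fin_succ]
  grind

/-- A nondegenerate skew form in four variables has an orthonormal basis in which it is block
diagonal. -/
theorem exists_orthonormalBasis_skew (A : Matrix (Fin 4) (Fin 4) ℝ) (hA : A.transpose = -A)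
    (hker : ∀ x, A.mulVec x = 0 → x = 0) :
    ∃ u : Fin 4 → Fin 4 → ℝ, (∀ i j, u i ⬝ᵥ u j = if i = j then 1 else 0) ∧
      u 0 ⬝ᵥ A.mulVec (u 2) = 0 ∧ u 0 ⬝ᵥ A.mulVec (u 3) = 0 ∧ u 1 ⬝ᵥ A.mulVec (u 2) = 0 ∧
      u 1 ⬝ᵥ A.mulVec (u 3) = 0 ∧ u 0 ⬝ᵥ A.mulVec (u 1) ≠ 0 ∧ u 2 ⬝ᵥ A.mulVec (u 3) ≠ 0 := by
  have hskew (x y : Fin 4 → ℝ) : x ⬝ᵥ A.mulVec y = -(y ⬝ᵥ A.mulVec x) := by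
    rw [Matrix.dotProduct_mulVec, ← Matrix.mulVec_transpose, hA, Matrix.neg_mulVec,
      neg_dotProduct, dotProduct_comm]
  have hS : (A * A).IsHermitian := by
    rw [Matrix.IsHermitian, Matrix.conjTranspose_eq_transpose_of_trivial, Matrix.transpose_mul, hA,
      neg_mul_neg]
  -- For an eigenvector `x` of the symmetric matrix `A²`, the plane spanned by `x` and `Ax` is
  -- `A`-invariant, and `x ⊥ Ax` by skewness. The orthogonal complement is then invariant too, so
  -- any orthonormal extension is block diagonal.
  set w := hS.eigenvectorBasis 0 with hw
  set x : Fin 4 → ℝ := w.ofLp with hx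
  have hAA : A.mulVec (A.mulVec x) = hS.eigenvalues 0 • x := by
    rw [Matrix.mulVec_mulVec]; exact hS.mulVec_eigenvectorBasis 0
  have hwn : ‖w‖ = 1 := hS.eigenvectorBasis.orthonormal.1 0
  have hx0 : x ≠ 0 := by
    intro h
    have : w = 0 := by ext i; exact congrFun h i
    simp [this] at hwn
  set y : EuclideanSpace ℝ (Fin 4) := WithLp.toLp 2 (A.mulVec x)
  have hy0 : y ≠ 0 := fun h => hx0 (hker x (by
    have := congrArg WithLp.ofLp h
    simpa [y] using this))
  have hinner (p q : EuclideanSpace ℝ (Fin 4)) : inner ℝ p q = q.ofLp ⬝ᵥ p.ofLp := by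
    simp [EuclideanSpace.inner_eq_star_dotProduct]
  have hxy : inner ℝ w y = 0 := by
    rw [hinner]
    have := hskew x x
    rw [dotProduct_comm]
    change x ⬝ᵥ A.mulVec x = 0
    linarith
  set z : EuclideanSpace ℝ (Fin 4) := ‖y‖⁻¹ • y
  have hzn : ‖z‖ = 1 := norm_smul_inv_norm hy0
  have hwz : inner ℝ w z = 0 := by simp [z, inner_smul_right, hxy]
  obtain ⟨u, hu⟩ := Orthonormal.exists_orthonormalBasis_extension_of_card_eq (𝕜 := ℝ)
    (E := EuclideanSpace ℝ (Fin 4)) (ι := Fin 4) (by simp) (v := ![w, z, 0, 0]) (s := {0, 1}) (by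
      rw [orthonormal_iff_ite]
      rintro ⟨i, hi⟩ ⟨j, hj⟩
      rcases hi with rfl | rfl <;> rcases hj with rfl | rfl <;>
        simp [hwn, hzn, hwz, real_inner_comm w z, Subtype.ext_iff])
  have hu0 : u 0 = w := hu 0 (by simp)
  have hu1 : u 1 = z := hu 1 (by simp)
  have horth := orthonormal_iff_ite.1 u.orthonormal
  refine ⟨fun i => (u i).ofLp, fun i j => ?_, ?_⟩
  · rw [← hinner, horth]
    simp only [eq_comm]
  have hk (k : Fin 4) (h0 : k ≠ 0) (h1 : k ≠ 1) : (u 0).ofLp ⬝ᵥ A.mulVec (u k).ofLp = 0 ∧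
      (u 1).ofLp ⬝ᵥ A.mulVec (u k).ofLp = 0 := by
    have g1 : (u k).ofLp ⬝ᵥ A.mulVec x = 0 := by
      have : inner ℝ (u 1) (u k) = (0 : ℝ) := by rw [horth, if_neg h1.symm]
      rw [hu1, inner_smul_left, hinner] at this
      simpa [hy0] using this
    have g0 : (u k).ofLp ⬝ᵥ x = 0 := by
      have : inner ℝ (u 0) (u k) = (0 : ℝ) := by rw [horth, if_neg h0.symm]
      rwa [hu0, hinner] at this
    constructor
    · rw [hskew, hu0, g1, neg_zero]
    · rw [hskew, hu1]
      have : z.ofLp = ‖y‖⁻¹ • A.mulVec x := rfl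
      rw [this, Matrix.mulVec_smul, hAA, dotProduct_smul, dotProduct_smul, g0]
      simp
  obtain ⟨h02, h12⟩ := hk 2 (by decide) (by decide)
  obtain ⟨h03, h13⟩ := hk 3 (by decide) (by decide)
  have hself (x : Fin 4 → ℝ) : x ⬝ᵥ A.mulVec x = 0 := by linarith [hskew x x]
  -- If a block were zero, `A` would kill a basis vector, against `hker`.
  have hne (k : Fin 4) (h : ∀ i, (u i).ofLp ⬝ᵥ A.mulVec (u k).ofLp = 0) : False := by
    have h1 : WithLp.toLp 2 (A.mulVec (u k).ofLp) = 0 := by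
      rw [← u.sum_repr (WithLp.toLp 2 (A.mulVec (u k).ofLp))]
      refine Finset.sum_eq_zero fun i _ => ?_
      rw [u.repr_apply_apply, hinner, dotProduct_comm, h, zero_smul]
    have h2 := hker _ (congrArg WithLp.ofLp h1)
    have h3 := u.orthonormal.1 k
    rw [show u k = 0 from congrArg (WithLp.toLp 2) h2] at h3
    simp at h3
  refine ⟨h02, h03, h12, h13, fun h01 => hne 1 fun i => ?_, fun h23 => hne 3 fun i => ?_⟩
  · fin_cases i
    · exact h01
    · exact hself _
    · exact (hskew _ _).trans (by simpa using h12)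
    · exact (hskew _ _).trans (by simpa using h13)
  · fin_cases i
    · exact h03
    · exact h13
    · exact h23
    · exact hself _

/-- The bracket is a 2-form on `⟨e_1, …, e_4⟩` with values in `⟨e_5⟩`, non-degenerate because it is
congruent to a multiple of `e^{12} + e^{34}`; an orthonormal basis brings it to blocks. -/
theorem IsN56.exists_form (h𝔤 : IsN56 𝔤) (g : LeftInvariantMetric 𝔤) :
    ∃ e, g.IsOrthonormal e ∧ ∃ μ₁₂ μ₃₄, FormN56 e μ₁₂ μ₃₄ := by
  obtain ⟨b, H⟩ := isN56_iff.1 h𝔤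
  obtain ⟨e, P, Q, he, -, -, hP, hQ, hP0, hQ0, H⟩ := H.exists_adapted g
  simp (disch := decide) [coordBracket, hP] at H
  obtain ⟨c, p, q, h, k, m, H, hc, hp, hq, hh, hk, hm⟩ : ∃ c p q h k m,
      HasBrackets e 0 0 c 0 p 0 q h k m ∧
      c = (P 0 0 * P 1 1 + P 0 2 * P 1 3 - P 0 3 * P 1 2) * Q 4 4 ∧
      p = (P 0 2 * P 2 3 - P 0 3 * P 2 2) * Q 4 4 ∧
      q = (P 1 2 * P 2 3 - P 1 3 * P 2 2) * Q 4 4 ∧ h = P 0 2 * P 3 3 * Q 4 4 ∧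
      k = P 1 2 * P 3 3 * Q 4 4 ∧ m = P 2 2 * P 3 3 * Q 4 4 :=
    ⟨_, _, _, _, _, _, H, by ring, by ring, by ring, by ring, by ring, by ring⟩
  set A : Matrix (Fin 4) (Fin 4) ℝ := !![0, c, p, h; -c, 0, q, k; -p, -q, 0, m; -h, -k, -m, 0]
  have hA : A.transpose = -A := by
    ext i j
    fin_cases i <;> fin_cases j <;> simp [A]
  obtain ⟨u, hu, h02, h03, h12, h13, h01, h23⟩ := exists_orthonormalBasis_skew A hA (by
    intro x hx
    have e0 := congrFun hx 0
    have e1 := congrFun hx 1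
    have e2 := congrFun hx 2
    have e3 := congrFun hx 3
    simp only [A, Matrix.mulVec, dotProduct, Fin.sum_univ_four, Matrix.of_apply, Matrix.cons_val,
      Pi.zero_apply, zero_mul, zero_add, add_zero] at e0 e1 e2 e3
    have hP0' := hP0 0
    have hP1' := hP0 1
    have hP2' := hP0 2
    have hP3' := hP0 3
    have hQ4' := hQ0 4
    -- The vanishing expressions in `y2` and `y3` are coordinates of `∑ x_i e_i` in the basis `b`;
    -- the triangular system is then solved for `x`.
    have y2 : x 0 * P 0 2 + x 1 * P 1 2 + x 2 * P 2 2 = 0 := by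
      refine (mul_eq_zero.1 (?_ : P 3 3 * Q 4 4 * _ = 0)).resolve_left (by positivity)
      rw [hh, hk, hm] at e3
      linear_combination -e3
    have y3 : x 0 * P 0 3 + x 1 * P 1 3 + x 2 * P 2 3 + x 3 * P 3 3 = 0 := by
      refine (mul_eq_zero.1 (?_ : P 2 2 * Q 4 4 * _ = 0)).resolve_left (by positivity)
      rw [hp, hq, hm] at e2
      linear_combination e2 + P 2 3 * Q 4 4 * y2
    have y0 : x 0 = 0 := by
      refine (mul_eq_zero.1 (?_ : P 0 0 * P 1 1 * Q 4 4 * _ = 0)).resolve_left (by positivity)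
      rw [hc, hq, hk] at e1
      linear_combination -e1 + P 1 2 * Q 4 4 * y3 - P 1 3 * Q 4 4 * y2
    have y1 : x 1 = 0 := by
      refine (mul_eq_zero.1 (?_ : P 0 0 * P 1 1 * Q 4 4 * _ = 0)).resolve_left (by positivity)
      rw [hc, hp, hh] at e0
      linear_combination e0 - P 0 2 * Q 4 4 * y3 + P 0 3 * Q 4 4 * y2
    rw [y0, y1] at y2 y3
    have y2' : x 2 = 0 := by simpa [hP2'] using y2
    rw [y2'] at y3
    have y3' : x 3 = 0 := by simpa [hP3'] using y3
    ext i
    fin_cases i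
    exacts [y0, y1, y2', y3'])
  simp only [A, Matrix.mulVec, dotProduct, Fin.sum_univ_four, Matrix.of_apply, Matrix.cons_val]
    at hu h02 h03 h12 h13 h01 h23
  set R : Fin 5 → Fin 5 → ℝ := ![![u 0 0, u 0 1, u 0 2, u 0 3, 0], ![u 1 0, u 1 1, u 1 2, u 1 3, 0],
    ![u 2 0, u 2 1, u 2 2, u 2 3, 0], ![u 3 0, u 3 1, u 3 2, u 3 3, 0], ![0, 0, 0, 0, 1]]
  obtain ⟨e', he', hv⟩ := he.rotate R (by
    simp [R, Fin.forall_fin_succ, Fin.sum_univ_five, hu])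
  refine ⟨e', he', _, _, formN56_iff.2 ⟨neg_ne_zero.2 h01, neg_ne_zero.2 h23,
    H.of_coords R hv _ _ _ _ _ _ _ _ _ _ ?_⟩⟩
  simp [R, coordBracket, funext_iff, Fin.forall_fin_succ]
  refine ⟨?_, ?_, ?_, ?_, ?_, ?_⟩
  · ring
  · linear_combination h02
  · linear_combination h03
  · linear_combination h12
  · linear_combination h13
  · ring

/-! ### Every metric has a nilpotent normal form -/

/-- The eight normal forms. -/
def IsNormalForm (e : Module.Basis (Fin 5) ℝ 𝔤) : Prop :=
  (∃ μ₁₂, FormL3A2 e μ₁₂) ∨ (∃ μ₁₂ l₁₂ l₁₃ μ₁₄, FormL4A1 e μ₁₂ l₁₂ l₁₃ μ₁₄) ∨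
  (∃ μ₁₂ μ₃₄, FormN56 e μ₁₂ μ₃₄) ∨ (∃ μ₁₂ μ₁₃, FormN55 e μ₁₂ μ₁₃) ∨
  (∃ μ₁₂ l₁₂ l₁₃ μ₁₄ μ₂₃, FormN54 e μ₁₂ l₁₂ l₁₃ μ₁₄ μ₂₃) ∨
  (∃ μ₁₂ l₄ μ₁₃ l₅ μ₂₃, FormN53 e μ₁₂ l₄ μ₁₃ l₅ μ₂₃) ∨
  (∃ μ₁₂ l₄ μ₁₃ l₅ l₁₃ μ₁₄, FormN52 e μ₁₂ l₄ μ₁₃ l₅ l₁₃ μ₁₄) ∨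
  (∃ μ₁₂ l₄ μ₁₃ l₅ l₁₃ μ₁₄ μ₂₃, FormN51 e μ₁₂ l₄ μ₁₃ l₅ l₁₃ μ₁₄ μ₂₃)

theorem IsListed.exists_isNormalForm (h𝔤 : IsListed 𝔤) (g : LeftInvariantMetric 𝔤) :
    ∃ e, g.IsOrthonormal e ∧ IsNormalForm e := by
  rcases h𝔤 with h | h | h | h | h | h | h | h <;> obtain ⟨e, he, hf⟩ := h.exists_form g
  · exact ⟨e, he, .inl hf⟩
  · exact ⟨e, he, .inr (.inl hf)⟩
  · exact ⟨e, he, .inr (.inr (.inl hf))⟩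
  · exact ⟨e, he, .inr (.inr (.inr (.inl hf)))⟩
  · exact ⟨e, he, .inr (.inr (.inr (.inr (.inl hf))))⟩
  · exact ⟨e, he, .inr (.inr (.inr (.inr (.inr (.inl hf)))))⟩
  · exact ⟨e, he, .inr (.inr (.inr (.inr (.inr (.inr (.inl hf))))))⟩
  · exact ⟨e, he, .inr (.inr (.inr (.inr (.inr (.inr (.inr hf))))))⟩

theorem HasBrackets.isNilpotentFrame {e : Module.Basis (Fin 5) ℝ 𝔤} {a b c d p f q h k m : ℝ}
    (H : HasBrackets e a b c d p f q h k m) : IsNilpotentFrame e := by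
  obtain ⟨h01, h02, h03, h04, h12, h13, h14, h23, h24, h34⟩ := H
  have key (i j : Fin 5) (hij : i < j) (l : Fin 5) (hl : l ≤ j) : e.repr ⁅e i, e j⁆ l = 0 := by
    fin_cases i <;> fin_cases j <;> first | exact absurd hij (by decide) | skip
    all_goals fin_cases l <;> first | exact absurd hl (by decide) | skip
    all_goals simp [h01, h02, h03, h04, h12, h13, h14, h23, h24, h34, Finsupp.single_apply]
  intro i j l hl
  rcases lt_trichotomy i j with hij | rfl | hij
  · exact key i j hij l (by omega)
  · simp
  · rw [← lie_skew, map_neg, Finsupp.neg_apply, key j i hij l (by omega), neg_zero]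

theorem IsNormalForm.isNilpotentFrame {e : Module.Basis (Fin 5) ℝ 𝔤} (h : IsNormalForm e) :
    IsNilpotentFrame e := by
  rcases h with ⟨_, h⟩ | ⟨_, _, _, _, h⟩ | ⟨_, _, h⟩ | ⟨_, _, h⟩ | ⟨_, _, _, _, _, h⟩ |
    ⟨_, _, _, _, _, h⟩ | ⟨_, _, _, _, _, _, h⟩ | ⟨_, _, _, _, _, _, _, h⟩
  · exact (formL3A2_iff.1 h).2.isNilpotentFrame
  · exact (formL4A1_iff.1 h).2.2.isNilpotentFrame
  · exact (formN56_iff.1 h).2.2.isNilpotentFrame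
  · exact (formN55_iff.1 h).2.2.isNilpotentFrame
  · exact (formN54_iff.1 h).2.2.2.isNilpotentFrame
  · exact (formN53_iff.1 h).2.2.2.isNilpotentFrame
  · exact (formN52_iff.1 h).2.2.2.isNilpotentFrame
  · exact (formN51_iff.1 h).2.2.2.2.isNilpotentFrame

end NormalForms

/-! ### The criterion in terms of structure constants -/

section Coefficients

variable {𝔤 : Type*} [LieRing 𝔤] [LieAlgebra ℝ 𝔤] {g : LeftInvariantMetric 𝔤}
  {e : Module.Basis (Fin 5) ℝ 𝔤} {a b c d p f q h k m : ℝ}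

/-- For `i < j < k` a bracket involving `e_k` has no component along `e_i` or `e_j`, so only
`g([e_i,e_j], e_k)` survives in the cyclic sum. Hence the scalar part of the square is `μ`. -/
theorem HasBrackets.torsionCoeff_eq (H : HasBrackets e a b c d p f q h k m)
    (he : g.IsOrthonormal e) :
    g.torsionCoeff e 0 1 2 = a ∧ g.torsionCoeff e 0 1 3 = b ∧ g.torsionCoeff e 0 1 4 = c ∧
    g.torsionCoeff e 0 2 3 = d ∧ g.torsionCoeff e 0 2 4 = p ∧ g.torsionCoeff e 0 3 4 = h ∧
    g.torsionCoeff e 1 2 3 = f ∧ g.torsionCoeff e 1 2 4 = q ∧ g.torsionCoeff e 1 3 4 = k ∧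
    g.torsionCoeff e 2 3 4 = m := by
  obtain ⟨h01, h02, h03, h04, h12, h13, h14, h23, h24, h34⟩ := H
  have hs {i j : Fin 5} (_ : i < j) : ⁅e j, e i⁆ = -⁅e i, e j⁆ := (lie_skew _ _).symm
  have he' (i j) : g.inner (e i) (e j) = if i = j then 1 else 0 := he i j
  simp (disch := decide) [LeftInvariantMetric.torsionCoeff, LeftInvariantMetric.torsion_apply, hs,
    h01, h02, h03, h04, h12, h13, h14, h23, h24, h34, he']

theorem HasBrackets.cubicNorm_eq (H : HasBrackets e a b c d p f q h k m)
    (he : g.IsOrthonormal e) : cubicNorm (g.torsionCoeff e) =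
      a ^ 2 + b ^ 2 + c ^ 2 + d ^ 2 + p ^ 2 + f ^ 2 + q ^ 2 + h ^ 2 + k ^ 2 + m ^ 2 := by
  obtain ⟨h1, h2, h3, h4, h5, h6, h7, h8, h9, h10⟩ := H.torsionCoeff_eq he
  rw [cubicNorm, h1, h2, h3, h4, h5, h6, h7, h8, h9, h10]
  ring

theorem HasBrackets.cubicVec_eq (H : HasBrackets e a b c d p f q h k m)
    (he : g.IsOrthonormal e) : cubicVec (g.torsionCoeff e) =
      ![2 * (a * h - b * p + c * d), 2 * (a * k - b * q + c * f), 2 * (a * m - d * q + p * f),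
        2 * (b * m - d * k + h * f), 2 * (c * m - p * k + h * q)] := by
  obtain ⟨h1, h2, h3, h4, h5, h6, h7, h8, h9, h10⟩ := H.torsionCoeff_eq he
  rw [cubicVec, h1, h2, h3, h4, h5, h6, h7, h8, h9, h10]

theorem HasBrackets.muConst_eq (H : HasBrackets e a b c d p f q h k m) : muConst e =
      a ^ 2 + b ^ 2 + c ^ 2 + d ^ 2 + p ^ 2 + f ^ 2 + q ^ 2 + h ^ 2 + k ^ 2 + m ^ 2 := by
  obtain ⟨h01, h02, h03, h04, h12, h13, h14, h23, h24, h34⟩ := H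
  have i0 : Finset.Ioi (0 : Fin 5) = {1, 2, 3, 4} := rfl
  have i1 : Finset.Ioi (1 : Fin 5) = {2, 3, 4} := rfl
  have i2 : Finset.Ioi (2 : Fin 5) = {3, 4} := rfl
  have i3 : Finset.Ioi (3 : Fin 5) = {4} := rfl
  have i4 : Finset.Ioi (4 : Fin 5) = ∅ := rfl
  simp (disch := decide) only [muConst, coframeDiff, Fin.sum_univ_five, i0, i1, i2, i3, i4,
    Finset.sum_insert, Finset.sum_singleton, Finset.sum_empty, Matrix.of_apply,
    h01, h02, h03, h04, h12, h13, h14, h23, h24, h34, map_add, map_smul, map_zero,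
    Finsupp.add_apply, Finsupp.smul_apply, Finsupp.zero_apply, Module.Basis.repr_self_apply,
    smul_eq_mul]
  simp
  ring

/-- The metric for which a given basis is orthonormal. -/
def metricOfBasis (e : Module.Basis (Fin 5) ℝ 𝔤) : LeftInvariantMetric 𝔤 where
  inner := ∑ i, (LinearMap.mul ℝ ℝ).compl₁₂ (e.coord i) (e.coord i)
  symm X Y := by simp [LinearMap.sum_apply, mul_comm]
  pos X hX := by
    simp only [LinearMap.sum_apply, LinearMap.compl₁₂_apply, LinearMap.mul_apply',
      Module.Basis.coord_apply]
    obtain ⟨i, hi⟩ : ∃ i, e.repr X i ≠ 0 := by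
      by_contra! h
      exact hX (e.ext_elem fun i => by simp [h i])
    exact Finset.sum_pos' (fun i _ => mul_self_nonneg _)
      ⟨i, Finset.mem_univ i, mul_self_pos.2 hi⟩

theorem isOrthonormal_metricOfBasis (e : Module.Basis (Fin 5) ℝ 𝔤) :
    (metricOfBasis e).IsOrthonormal e := by
  intro i j
  simp [metricOfBasis, LinearMap.sum_apply, Finsupp.single_apply]

end Coefficients

section Group

variable {G : Type*} [TopologicalSpace G] [ChartedSpace (EuclideanSpace ℝ (Fin 5)) G] [Group G]
  [LieGroup (𝓡 5) ∞ G] [LieRing.IsNilpotent (GroupLieAlgebra (𝓡 5) G)]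
  {W : Type*} [NormedAddCommGroup W] [NormedSpace ℝ W] [Module Cl5 W] [IsScalarTower ℝ Cl5 W]
  {g : LeftInvariantMetric (GroupLieAlgebra (𝓡 5) G)}
  {e f : Module.Basis (Fin 5) ℝ (GroupLieAlgebra (𝓡 5) G)} {a b c d p r q h k m : ℝ}

theorem HasBrackets.diracSquareFormula (H : HasBrackets e a b c d p r q h k m)
    (he : g.IsOrthonormal e) {v : Fin 5 → ℝ}
    (hv : v = ![2 * (a * h - b * p + c * d), 2 * (a * k - b * q + c * r),
      2 * (a * m - d * q + p * r), 2 * (b * m - d * k + h * r), 2 * (c * m - p * k + h * q)]) :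
    DiracSquareFormula W g e v := by
  rw [hv, ← H.cubicVec_eq he]
  exact NilSpin.diracSquareFormula he (by rw [H.muConst_eq, H.cubicNorm_eq he])

theorem HasBrackets.hasHarmonicSpinor_iff [Nontrivial W] (H : HasBrackets e a b c d p r q h k m)
    (Γ : Subgroup G) (he : g.IsOrthonormal e) (hf : g.IsOrthonormal f) :
    HasHarmonicSpinor W Γ g f ↔
      (a ^ 2 + b ^ 2 + c ^ 2 + d ^ 2 + p ^ 2 + r ^ 2 + q ^ 2 + h ^ 2 + k ^ 2 + m ^ 2) ^ 2 =
        (2 * (a * h - b * p + c * d)) ^ 2 + (2 * (a * k - b * q + c * r)) ^ 2 +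
        (2 * (a * m - d * q + p * r)) ^ 2 + (2 * (b * m - d * k + h * r)) ^ 2 +
        (2 * (c * m - p * k + h * q)) ^ 2 := by
  rw [NilSpin.hasHarmonicSpinor_iff Γ he hf, H.cubicNorm_eq he, H.cubicVec_eq he]
  simp [Fin.sum_univ_five]

theorem IsNilpotentFrame.exists_diracSquareFormula [Nontrivial W] (h : IsNilpotentFrame e)
    (Γ : Subgroup G) (he : g.IsOrthonormal e) (hf : g.IsOrthonormal f) :
    ∃ v : Fin 5 → ℝ, DiracSquareFormula W g e v ∧
      (HasHarmonicSpinor W Γ g f ↔ muConst e = Real.sqrt (∑ i, v i ^ 2)) := by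
  obtain ⟨a, b, c, d, p, r, q, h, k, m, H⟩ := h.exists_hasBrackets
  have hμ : muConst e = cubicNorm (g.torsionCoeff e) := by rw [H.muConst_eq, H.cubicNorm_eq he]
  refine ⟨_, NilSpin.diracSquareFormula he hμ, ?_⟩
  rw [NilSpin.hasHarmonicSpinor_iff Γ he hf, hμ, eq_comm (b := Real.sqrt _)]
  constructor
  · intro h
    rw [← h, Real.sqrt_sq (cubicNorm_nonneg _)]
  · intro h
    rw [← h, Real.sq_sqrt (Finset.sum_nonneg fun i _ => sq_nonneg _)]

/-! ### The eight normal forms -/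

variable [Nontrivial W] (Γ : Subgroup G)

theorem FormL3A2.dirac {μ₁₂ : ℝ} (h : FormL3A2 e μ₁₂)
    (he : g.IsOrthonormal e) (hf : g.IsOrthonormal f) :
    DiracSquareFormula W g e 0 ∧ ¬ HasHarmonicSpinor W Γ g f := by
  obtain ⟨h₁, H⟩ := formL3A2_iff.1 h
  refine ⟨H.diracSquareFormula he ?_, ?_⟩
  · ext i
    fin_cases i <;> simp
  rw [H.hasHarmonicSpinor_iff Γ he hf]
  · intro h
    have : 0 < μ₁₂ ^ 2 := by positivity
    nlinarith

theorem FormL4A1.dirac {μ₁₂ l₁₂ l₁₃ μ₁₄ : ℝ} (h : FormL4A1 e μ₁₂ l₁₂ l₁₃ μ₁₄)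
    (he : g.IsOrthonormal e) (hf : g.IsOrthonormal f) :
    DiracSquareFormula W g e ![-2 * μ₁₂ * l₁₃, 0, 0, 0, 0] ∧ ¬ HasHarmonicSpinor W Γ g f := by
  obtain ⟨h₁, h₂, H⟩ := formL4A1_iff.1 h
  refine ⟨H.diracSquareFormula he ?_, ?_⟩
  · ext i
    fin_cases i <;> simp <;> ring
  rw [H.hasHarmonicSpinor_iff Γ he hf]
  · intro h
    -- This is `μ² - ‖v‖²` written as a sum of non-negative terms, the last of which is positive.
    have h1 : ((μ₁₂ ^ 2 - l₁₃ ^ 2) ^ 2 + (l₁₂ ^ 2 + μ₁₄ ^ 2) ^ 2 +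
      2 * (μ₁₂ ^ 2 + l₁₃ ^ 2) * (l₁₂ ^ 2 + μ₁₄ ^ 2)) = 0 := by linear_combination h
    have : 0 < (μ₁₂ ^ 2 + l₁₃ ^ 2) * (l₁₂ ^ 2 + μ₁₄ ^ 2) := by positivity
    nlinarith [sq_nonneg (μ₁₂ ^ 2 - l₁₃ ^ 2), sq_nonneg (l₁₂ ^ 2 + μ₁₄ ^ 2)]

theorem FormN56.dirac {μ₁₂ μ₃₄ : ℝ} (h : FormN56 e μ₁₂ μ₃₄)
    (he : g.IsOrthonormal e) (hf : g.IsOrthonormal f) :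
    DiracSquareFormula W g e ![0, 0, 0, 0, 2 * μ₁₂ * μ₃₄] ∧ (HasHarmonicSpinor W Γ g f ↔
      μ₁₂ = μ₃₄ ∨ μ₁₂ = -μ₃₄) := by
  obtain ⟨h₁, h₂, H⟩ := formN56_iff.1 h
  refine ⟨H.diracSquareFormula he ?_, ?_⟩
  · ext i
    fin_cases i <;> simp <;> ring
  rw [H.hasHarmonicSpinor_iff Γ he hf]
  -- Here `μ² - ‖v‖² = (μ₁₂² - μ₃₄²)²`; the same identity with `μ₁₃` serves `N_{5,5}`.
  · rw [← sq_eq_sq_iff_eq_or_eq_neg, ← sub_eq_zero (b := μ₃₄ ^ 2), ← sq_eq_zero_iff (a := _ - _),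
      ← sub_eq_zero]
    ring_nf

theorem FormN55.dirac {μ₁₂ μ₁₃ : ℝ} (h : FormN55 e μ₁₂ μ₁₃)
    (he : g.IsOrthonormal e) (hf : g.IsOrthonormal f) :
    DiracSquareFormula W g e ![-2 * μ₁₂ * μ₁₃, 0, 0, 0, 0] ∧ (HasHarmonicSpinor W Γ g f ↔
      μ₁₂ = μ₁₃ ∨ μ₁₂ = -μ₁₃) := by
  obtain ⟨h₁, h₂, H⟩ := formN55_iff.1 h
  refine ⟨H.diracSquareFormula he ?_, ?_⟩
  · ext i
    fin_cases i <;> simp <;> ring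
  rw [H.hasHarmonicSpinor_iff Γ he hf]
  · rw [← sq_eq_sq_iff_eq_or_eq_neg, ← sub_eq_zero (b := μ₁₃ ^ 2), ← sq_eq_zero_iff (a := _ - _),
      ← sub_eq_zero]
    ring_nf

theorem FormN54.dirac {μ₁₂ l₁₂ l₁₃ μ₁₄ μ₂₃ : ℝ} (h : FormN54 e μ₁₂ l₁₂ l₁₃ μ₁₄ μ₂₃)
    (he : g.IsOrthonormal e) (hf : g.IsOrthonormal f) :
    DiracSquareFormula W g e ![-2 * μ₁₂ * l₁₃, -2 * μ₁₂ * μ₂₃, 0, 0, 2 * μ₁₄ * μ₂₃] ∧ (HasHarmonicSpinor W Γ g f ↔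
      l₁₂ = 0 ∧ l₁₃ = 0 ∧ μ₁₄ ^ 2 = μ₂₃ ^ 2 - μ₁₂ ^ 2) := by
  obtain ⟨h₁, h₂, h₃, H⟩ := formN54_iff.1 h
  refine ⟨H.diracSquareFormula he ?_, ?_⟩
  · ext i
    fin_cases i <;> simp <;> ring
  rw [H.hasHarmonicSpinor_iff Γ he hf]
  · constructor
    · intro h
      -- Again `μ² - ‖v‖²` as a sum of non-negative terms; each must vanish, and `μ₁₄ ≠ 0` forces
      -- `l₁₃ = 0`.
      have h1 : (μ₂₃ ^ 2 + l₁₃ ^ 2 - μ₁₂ ^ 2 - μ₁₄ ^ 2) ^ 2 + 4 * (l₁₃ * μ₁₄) ^ 2 + l₁₂ ^ 4 +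
          2 * l₁₂ ^ 2 * (μ₁₂ ^ 2 + l₁₃ ^ 2 + μ₁₄ ^ 2 + μ₂₃ ^ 2) = 0 := by linear_combination h
      have n1 := sq_nonneg (μ₂₃ ^ 2 + l₁₃ ^ 2 - μ₁₂ ^ 2 - μ₁₄ ^ 2)
      have n2 := sq_nonneg (l₁₃ * μ₁₄)
      have n3 : 0 ≤ l₁₂ ^ 4 := by positivity
      have n4 : 0 ≤ 2 * l₁₂ ^ 2 * (μ₁₂ ^ 2 + l₁₃ ^ 2 + μ₁₄ ^ 2 + μ₂₃ ^ 2) := by positivity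
      have z1 : l₁₂ = 0 := pow_eq_zero_iff (n := 4) (by norm_num) |>.1 (by linarith)
      have z2 : l₁₃ = 0 := by
        have : l₁₃ * μ₁₄ = 0 := sq_eq_zero_iff.1 (by linarith)
        exact (mul_eq_zero.1 this).resolve_right h₂
      have z3 : μ₂₃ ^ 2 + l₁₃ ^ 2 - μ₁₂ ^ 2 - μ₁₄ ^ 2 = 0 := sq_eq_zero_iff.1 (by linarith)
      refine ⟨z1, z2, ?_⟩
      rw [z2] at z3
      linear_combination -z3
    · rintro ⟨rfl, rfl, hμ⟩
      linear_combination (-μ₂₃ ^ 2 + μ₁₂ ^ 2 + μ₁₄ ^ 2) * hμ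

theorem FormN53.dirac {μ₁₂ l₄ μ₁₃ l₅ μ₂₃ : ℝ} (h : FormN53 e μ₁₂ l₄ μ₁₃ l₅ μ₂₃)
    (he : g.IsOrthonormal e) (hf : g.IsOrthonormal f) :
    DiracSquareFormula W g e ![2 * μ₁₃ * l₅, -2 * l₄ * μ₂₃, -2 * μ₁₃ * μ₂₃, 0, 0] ∧ ¬ HasHarmonicSpinor W Γ g f := by
  obtain ⟨h₁, h₂, h₃, H⟩ := formN53_iff.1 h
  refine ⟨H.diracSquareFormula he ?_, ?_⟩
  · ext i
    fin_cases i <;> simp <;> ring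
  rw [H.hasHarmonicSpinor_iff Γ he hf]
  · intro h
    -- The obstruction is the positive term `μ₁₂⁴` in `μ² - ‖v‖²`.
    have h1 : (l₅ ^ 2 + μ₂₃ ^ 2 - μ₁₃ ^ 2 - l₄ ^ 2) ^ 2 + 4 * (l₄ * l₅) ^ 2 + μ₁₂ ^ 4 +
      2 * μ₁₂ ^ 2 * (l₄ ^ 2 + μ₁₃ ^ 2 + l₅ ^ 2 + μ₂₃ ^ 2) = 0 := by linear_combination h
    have : 0 < μ₁₂ ^ 4 := by positivity
    have : 0 ≤ 2 * μ₁₂ ^ 2 * (l₄ ^ 2 + μ₁₃ ^ 2 + l₅ ^ 2 + μ₂₃ ^ 2) := by positivity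
    nlinarith [sq_nonneg (l₅ ^ 2 + μ₂₃ ^ 2 - μ₁₃ ^ 2 - l₄ ^ 2), sq_nonneg (l₄ * l₅)]

theorem FormN52.dirac {μ₁₂ l₄ μ₁₃ l₅ l₁₃ μ₁₄ : ℝ} (h : FormN52 e μ₁₂ l₄ μ₁₃ l₅ l₁₃ μ₁₄)
    (he : g.IsOrthonormal e) (hf : g.IsOrthonormal f) :
    DiracSquareFormula W g e ![2 * (μ₁₂ * μ₁₄ - l₄ * l₁₃ + μ₁₃ * l₅), 0, 0, 0, 0] ∧ (HasHarmonicSpinor W Γ g f ↔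
      (μ₁₂ = μ₁₄ ∧ l₄ = -l₁₃ ∧ μ₁₃ = l₅) ∨ (μ₁₂ = -μ₁₄ ∧ l₄ = l₁₃ ∧ μ₁₃ = -l₅)) := by
  obtain ⟨h₁, h₂, h₃, H⟩ := formN52_iff.1 h
  refine ⟨H.diracSquareFormula he ?_, ?_⟩
  · ext i
    fin_cases i <;> simp <;> ring
  rw [H.hasHarmonicSpinor_iff Γ he hf]
  · constructor
    · intro h
      -- As `v` has only a first component, `μ² - ‖v‖² = (μ - v_1)(μ + v_1)`, and each factor is a
      -- sum of three squares; the factors give the two choices of sign.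
      have h1 : ((μ₁₂ - μ₁₄) ^ 2 + (l₄ + l₁₃) ^ 2 + (μ₁₃ - l₅) ^ 2) *
          ((μ₁₂ + μ₁₄) ^ 2 + (l₄ - l₁₃) ^ 2 + (μ₁₃ + l₅) ^ 2) = 0 := by linear_combination h
      rcases mul_eq_zero.1 h1 with h2 | h2
      · refine Or.inl ⟨?_, ?_, ?_⟩ <;> nlinarith [sq_nonneg (μ₁₂ - μ₁₄), sq_nonneg (l₄ + l₁₃), sq_nonneg (μ₁₃ - l₅)]
      · refine Or.inr ⟨?_, ?_, ?_⟩ <;> nlinarith [sq_nonneg (μ₁₂ + μ₁₄), sq_nonneg (l₄ - l₁₃), sq_nonneg (μ₁₃ + l₅)]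
    · rintro (⟨rfl, rfl, rfl⟩ | ⟨rfl, rfl, rfl⟩) <;> ring

theorem FormN51.dirac {μ₁₂ l₄ μ₁₃ l₅ l₁₃ μ₁₄ μ₂₃ : ℝ} (h : FormN51 e μ₁₂ l₄ μ₁₃ l₅ l₁₃ μ₁₄ μ₂₃)
    (he : g.IsOrthonormal e) (hf : g.IsOrthonormal f) :
    DiracSquareFormula W g e ![2 * (μ₁₂ * μ₁₄ - l₄ * l₁₃ + μ₁₃ * l₅), -2 * l₄ * μ₂₃, -2 * μ₁₃ * μ₂₃, 0,
        2 * μ₁₄ * μ₂₃] ∧ (HasHarmonicSpinor W Γ g f ↔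
      (μ₁₂ ^ 2 + l₄ ^ 2 + μ₁₃ ^ 2 + l₅ ^ 2 + l₁₃ ^ 2 + μ₁₄ ^ 2 + μ₂₃ ^ 2) ^ 2 =
        4 * (μ₁₄ ^ 2 * μ₂₃ ^ 2 + (-μ₁₃ * l₅ + l₁₃ * l₄ - μ₁₂ * μ₁₄) ^ 2 +
          l₄ ^ 2 * μ₂₃ ^ 2 + μ₁₃ ^ 2 * μ₂₃ ^ 2)) := by
  obtain ⟨h₁, h₂, h₃, h₄, H⟩ := formN51_iff.1 h
  refine ⟨H.diracSquareFormula he ?_, ?_⟩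
  · ext i
    fin_cases i <;> simp <;> ring
  rw [H.hasHarmonicSpinor_iff Γ he hf]
  · ring_nf

/-! ### Existence of metrics with harmonic spinors -/

theorem HasBrackets.exists_harmonic (H : HasBrackets e a b c d p r q h k m)
    (hc : (a ^ 2 + b ^ 2 + c ^ 2 + d ^ 2 + p ^ 2 + r ^ 2 + q ^ 2 + h ^ 2 + k ^ 2 + m ^ 2) ^ 2 =
        (2 * (a * h - b * p + c * d)) ^ 2 + (2 * (a * k - b * q + c * r)) ^ 2 +
        (2 * (a * m - d * q + p * r)) ^ 2 + (2 * (b * m - d * k + h * r)) ^ 2 +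
        (2 * (c * m - p * k + h * q)) ^ 2) :
    ∃ g : LeftInvariantMetric (GroupLieAlgebra (𝓡 5) G), ∀ f, g.IsOrthonormal f →
      HasHarmonicSpinor W Γ g f :=
  ⟨metricOfBasis e, fun _ hf =>
    (H.hasHarmonicSpinor_iff Γ (isOrthonormal_metricOfBasis e) hf).2 hc⟩

variable (W) in
theorem IsN56.exists_harmonic (h𝔤 : IsN56 (GroupLieAlgebra (𝓡 5) G)) :
    ∃ g : LeftInvariantMetric (GroupLieAlgebra (𝓡 5) G), ∀ f, g.IsOrthonormal f →
      HasHarmonicSpinor W Γ g f := by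
  obtain ⟨b, H⟩ := isN56_iff.1 h𝔤
  exact H.exists_harmonic Γ (by norm_num)

variable (W) in
theorem IsN55.exists_harmonic (h𝔤 : IsN55 (GroupLieAlgebra (𝓡 5) G)) :
    ∃ g : LeftInvariantMetric (GroupLieAlgebra (𝓡 5) G), ∀ f, g.IsOrthonormal f →
      HasHarmonicSpinor W Γ g f := by
  obtain ⟨b, H⟩ := isN55_iff.1 h𝔤
  exact H.exists_harmonic Γ (by norm_num)

variable (W) in
theorem IsN54.exists_harmonic (h𝔤 : IsN54 (GroupLieAlgebra (𝓡 5) G)) :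
    ∃ g : LeftInvariantMetric (GroupLieAlgebra (𝓡 5) G), ∀ f, g.IsOrthonormal f →
      HasHarmonicSpinor W Γ g f := by
  obtain ⟨b, H⟩ := isN54_iff.1 h𝔤
  -- The scaling produces the structure constants `4, 5, 3`, since the condition is Pythagorean: `3²
  -- = 5² - 4²`.
  obtain ⟨e, H⟩ := H.change ![![1, 0, 0, 0, 0], ![0, 1, 0, 0, 0], ![0, 0, 5 / 12, 0, 0],
    ![0, 0, 0, 1 / 4, 0], ![0, 0, 0, 0, 1 / 12]]
    (by simp [Matrix.det_succ_row_zero, Fin.sum_univ_succ, Fin.succAbove])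
    0 4 0 0 0 0 5 3 0 0
    (by simp [coordBracket, funext_iff, Fin.forall_fin_succ]; norm_num)
  exact H.exists_harmonic Γ (by norm_num)

variable (W) in
theorem IsN52.exists_harmonic (h𝔤 : IsN52 (GroupLieAlgebra (𝓡 5) G)) :
    ∃ g : LeftInvariantMetric (GroupLieAlgebra (𝓡 5) G), ∀ f, g.IsOrthonormal f →
      HasHarmonicSpinor W Γ g f := by
  obtain ⟨b, H⟩ := isN52_iff.1 h𝔤
  -- Replacing `e_3` by `e_3 - e_5` introduces the coefficient `λ_5`, which must match `μ₁₃` and is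
  -- therefore non-zero.
  obtain ⟨e, H⟩ := H.change ![![1, 0, 0, 0, 0], ![0, 1, 0, 0, 0], ![0, 0, 1, 0, -1],
    ![0, 0, 0, 1, 0], ![0, 0, 0, 0, 1]]
    (by simp [Matrix.det_succ_row_zero, Fin.sum_univ_succ, Fin.succAbove])
    1 0 1 1 0 0 0 1 0 0
    (by simp [coordBracket, funext_iff, Fin.forall_fin_succ])
  exact H.exists_harmonic Γ (by norm_num)

variable (W) in
theorem IsN51.exists_harmonic (h𝔤 : IsN51 (GroupLieAlgebra (𝓡 5) G)) :
    ∃ g : LeftInvariantMetric (GroupLieAlgebra (𝓡 5) G), ∀ f, g.IsOrthonormal f →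
      HasHarmonicSpinor W Γ g f := by
  obtain ⟨b, H⟩ := isN51_iff.1 h𝔤
  -- The target constants `1, 1, 3, 4, 3` give `μ = 1 + 1 + 9 + 16 + 9 = 36` and `‖v‖² = 12² + 24² +
  -- 24² = 36²`.
  obtain ⟨e, H⟩ := H.change ![![1, 0, 0, 0, 0], ![0, 4 / 9, 0, 0, 0], ![0, 0, 4 / 9, 0, -4 / 81],
    ![0, 0, 0, 4 / 27, 0], ![0, 0, 0, 0, 4 / 81]]
    (by simp [Matrix.det_succ_row_zero, Fin.sum_univ_succ, Fin.succAbove])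
    1 0 1 3 0 0 4 3 0 0
    (by simp [coordBracket, funext_iff, Fin.forall_fin_succ]; norm_num)
  exact H.exists_harmonic Γ (by norm_num)

/-! ### Assembly of the theorem -/

theorem finrank_groupLieAlgebra (G : Type*) [TopologicalSpace G]
    [ChartedSpace (EuclideanSpace ℝ (Fin 5)) G] [Group G] :
    Module.finrank ℝ (GroupLieAlgebra (𝓡 5) G) = 5 :=
  finrank_euclideanSpace_fin (𝕜 := ℝ) (n := 5)

theorem not_hasHarmonicSpinor_of_isomorphic (h𝔤 : IsL3A2 (GroupLieAlgebra (𝓡 5) G) ∨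
    IsL4A1 (GroupLieAlgebra (𝓡 5) G) ∨ IsN53 (GroupLieAlgebra (𝓡 5) G))
    (hf : g.IsOrthonormal f) : ¬ HasHarmonicSpinor W Γ g f := by
  rcases h𝔤 with h | h | h
  · obtain ⟨e, he, _, h⟩ := h.exists_form g
    exact (h.dirac Γ he hf).2
  · obtain ⟨e, he, _, _, _, _, h⟩ := h.exists_form g
    exact (h.dirac Γ he hf).2
  · obtain ⟨e, he, _, _, _, _, _, h⟩ := h.exists_form g
    exact (h.dirac Γ he hf).2

end Group

end NilSpin

end

theorem mainTheorem1
    {G : Type*} [TopologicalSpace G] [ChartedSpace (EuclideanSpace ℝ (Fin 5)) G] [Group G]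
    [LieGroup (𝓡 5) ∞ G] [T2Space G] [SecondCountableTopology G] [SimplyConnectedSpace G]
    (hnil : LieRing.IsNilpotent (GroupLieAlgebra (𝓡 5) G))
    (hnab : ¬ IsLieAbelian (GroupLieAlgebra (𝓡 5) G))
    (Γ : Subgroup G) [DiscreteTopology Γ] [CompactSpace (Quotient (QuotientGroup.rightRel Γ))]
    {W : Type*} [NormedAddCommGroup W] [NormedSpace ℝ W] [Module NilSpin.Cl5 W]
    [IsScalarTower ℝ NilSpin.Cl5 W] [IsSimpleModule NilSpin.Cl5 W] :
    -- (1) harmonic spinors force the Lie algebra to be one of five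
    (∀ g : NilSpin.LeftInvariantMetric (GroupLieAlgebra (𝓡 5) G), ∀ f, g.IsOrthonormal f →
      NilSpin.HasHarmonicSpinor W Γ g f →
        NilSpin.IsN56 (GroupLieAlgebra (𝓡 5) G) ∨ NilSpin.IsN55 (GroupLieAlgebra (𝓡 5) G) ∨
        NilSpin.IsN54 (GroupLieAlgebra (𝓡 5) G) ∨ NilSpin.IsN52 (GroupLieAlgebra (𝓡 5) G) ∨
        NilSpin.IsN51 (GroupLieAlgebra (𝓡 5) G)) ∧
    -- (2) the remaining three algebras never admit them
    (NilSpin.IsL3A2 (GroupLieAlgebra (𝓡 5) G) ∨ NilSpin.IsL4A1 (GroupLieAlgebra (𝓡 5) G) ∨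
        NilSpin.IsN53 (GroupLieAlgebra (𝓡 5) G) →
      ∀ g : NilSpin.LeftInvariantMetric (GroupLieAlgebra (𝓡 5) G), ∀ f, g.IsOrthonormal f →
        ¬ NilSpin.HasHarmonicSpinor W Γ g f) ∧
    -- (3) each of the five algebras admits them for some metric
    (NilSpin.IsN56 (GroupLieAlgebra (𝓡 5) G) ∨ NilSpin.IsN55 (GroupLieAlgebra (𝓡 5) G) ∨
        NilSpin.IsN54 (GroupLieAlgebra (𝓡 5) G) ∨ NilSpin.IsN52 (GroupLieAlgebra (𝓡 5) G) ∨
        NilSpin.IsN51 (GroupLieAlgebra (𝓡 5) G) →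
      ∃ g : NilSpin.LeftInvariantMetric (GroupLieAlgebra (𝓡 5) G), ∀ f, g.IsOrthonormal f →
        NilSpin.HasHarmonicSpinor W Γ g f) ∧
    ∀ g : NilSpin.LeftInvariantMetric (GroupLieAlgebra (𝓡 5) G),
      -- (4) every metric has an orthonormal nilpotent basis in one of the eight normal forms
      (∃ e, g.IsOrthonormal e ∧ NilSpin.IsNilpotentFrame e ∧
        ((∃ μ₁₂, NilSpin.FormL3A2 e μ₁₂) ∨
          (∃ μ₁₂ l₁₂ l₁₃ μ₁₄, NilSpin.FormL4A1 e μ₁₂ l₁₂ l₁₃ μ₁₄) ∨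
          (∃ μ₁₂ μ₃₄, NilSpin.FormN56 e μ₁₂ μ₃₄) ∨
          (∃ μ₁₂ μ₁₃, NilSpin.FormN55 e μ₁₂ μ₁₃) ∨
          (∃ μ₁₂ l₁₂ l₁₃ μ₁₄ μ₂₃, NilSpin.FormN54 e μ₁₂ l₁₂ l₁₃ μ₁₄ μ₂₃) ∨
          (∃ μ₁₂ l₄ μ₁₃ l₅ μ₂₃, NilSpin.FormN53 e μ₁₂ l₄ μ₁₃ l₅ μ₂₃) ∨
          (∃ μ₁₂ l₄ μ₁₃ l₅ l₁₃ μ₁₄, NilSpin.FormN52 e μ₁₂ l₄ μ₁₃ l₅ l₁₃ μ₁₄) ∨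
          (∃ μ₁₂ l₄ μ₁₃ l₅ l₁₃ μ₁₄ μ₂₃,
            NilSpin.FormN51 e μ₁₂ l₄ μ₁₃ l₅ l₁₃ μ₁₄ μ₂₃))) ∧
      ∀ e, g.IsOrthonormal e → ∀ f, g.IsOrthonormal f →
        -- (5) in any orthonormal nilpotent basis: square formula and criterion
        (NilSpin.IsNilpotentFrame e → ∃ v : Fin 5 → ℝ, NilSpin.DiracSquareFormula W g e v ∧
          (NilSpin.HasHarmonicSpinor W Γ g f ↔
            NilSpin.muConst e = Real.sqrt (∑ i, v i ^ 2))) ∧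
        -- (6) the explicit vectors and conditions in the normal forms
        (∀ μ₁₂, NilSpin.FormL3A2 e μ₁₂ →
          NilSpin.DiracSquareFormula W g e 0 ∧ ¬ NilSpin.HasHarmonicSpinor W Γ g f) ∧
        (∀ μ₁₂ l₁₂ l₁₃ μ₁₄, NilSpin.FormL4A1 e μ₁₂ l₁₂ l₁₃ μ₁₄ →
          NilSpin.DiracSquareFormula W g e ![-2 * μ₁₂ * l₁₃, 0, 0, 0, 0] ∧
          ¬ NilSpin.HasHarmonicSpinor W Γ g f) ∧
        (∀ μ₁₂ μ₃₄, NilSpin.FormN56 e μ₁₂ μ₃₄ →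
          NilSpin.DiracSquareFormula W g e ![0, 0, 0, 0, 2 * μ₁₂ * μ₃₄] ∧
          (NilSpin.HasHarmonicSpinor W Γ g f ↔ μ₁₂ = μ₃₄ ∨ μ₁₂ = -μ₃₄)) ∧
        (∀ μ₁₂ μ₁₃, NilSpin.FormN55 e μ₁₂ μ₁₃ →
          NilSpin.DiracSquareFormula W g e ![-2 * μ₁₂ * μ₁₃, 0, 0, 0, 0] ∧
          (NilSpin.HasHarmonicSpinor W Γ g f ↔ μ₁₂ = μ₁₃ ∨ μ₁₂ = -μ₁₃)) ∧
        (∀ μ₁₂ l₁₂ l₁₃ μ₁₄ μ₂₃, NilSpin.FormN54 e μ₁₂ l₁₂ l₁₃ μ₁₄ μ₂₃ →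
          NilSpin.DiracSquareFormula W g e
            ![-2 * μ₁₂ * l₁₃, -2 * μ₁₂ * μ₂₃, 0, 0, 2 * μ₁₄ * μ₂₃] ∧
          (NilSpin.HasHarmonicSpinor W Γ g f ↔
            l₁₂ = 0 ∧ l₁₃ = 0 ∧ μ₁₄ ^ 2 = μ₂₃ ^ 2 - μ₁₂ ^ 2)) ∧
        (∀ μ₁₂ l₄ μ₁₃ l₅ μ₂₃, NilSpin.FormN53 e μ₁₂ l₄ μ₁₃ l₅ μ₂₃ →
          NilSpin.DiracSquareFormula W g e
            ![2 * μ₁₃ * l₅, -2 * l₄ * μ₂₃, -2 * μ₁₃ * μ₂₃, 0, 0] ∧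
          ¬ NilSpin.HasHarmonicSpinor W Γ g f) ∧
        (∀ μ₁₂ l₄ μ₁₃ l₅ l₁₃ μ₁₄, NilSpin.FormN52 e μ₁₂ l₄ μ₁₃ l₅ l₁₃ μ₁₄ →
          NilSpin.DiracSquareFormula W g e
            ![2 * (μ₁₂ * μ₁₄ - l₄ * l₁₃ + μ₁₃ * l₅), 0, 0, 0, 0] ∧
          (NilSpin.HasHarmonicSpinor W Γ g f ↔
            (μ₁₂ = μ₁₄ ∧ l₄ = -l₁₃ ∧ μ₁₃ = l₅) ∨ (μ₁₂ = -μ₁₄ ∧ l₄ = l₁₃ ∧ μ₁₃ = -l₅))) ∧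
        (∀ μ₁₂ l₄ μ₁₃ l₅ l₁₃ μ₁₄ μ₂₃, NilSpin.FormN51 e μ₁₂ l₄ μ₁₃ l₅ l₁₃ μ₁₄ μ₂₃ →
          NilSpin.DiracSquareFormula W g e
            ![2 * (μ₁₂ * μ₁₄ - l₄ * l₁₃ + μ₁₃ * l₅), -2 * l₄ * μ₂₃, -2 * μ₁₃ * μ₂₃, 0,
              2 * μ₁₄ * μ₂₃] ∧
          (NilSpin.HasHarmonicSpinor W Γ g f ↔
            (μ₁₂ ^ 2 + l₄ ^ 2 + μ₁₃ ^ 2 + l₅ ^ 2 + l₁₃ ^ 2 + μ₁₄ ^ 2 + μ₂₃ ^ 2) ^ 2 =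
              4 * (μ₁₄ ^ 2 * μ₂₃ ^ 2 + (-μ₁₃ * l₅ + l₁₃ * l₄ - μ₁₂ * μ₁₄) ^ 2 +
                l₄ ^ 2 * μ₂₃ ^ 2 + μ₁₃ ^ 2 * μ₂₃ ^ 2))) := by
  have : Nontrivial W := IsSimpleModule.nontrivial NilSpin.Cl5 W
  have hlist := NilSpin.isListed_of_finrank_eq (NilSpin.finrank_groupLieAlgebra G) hnab
  refine ⟨fun g f hf hs => ?_, fun h g f hf =>
    NilSpin.not_hasHarmonicSpinor_of_isomorphic Γ h hf, fun h => ?_, fun g => ⟨?_, ?_⟩⟩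
  · rcases hlist with h | h | h | h | h | h | h | h
    · exact absurd hs (NilSpin.not_hasHarmonicSpinor_of_isomorphic Γ (.inl h) hf)
    · exact absurd hs (NilSpin.not_hasHarmonicSpinor_of_isomorphic Γ (.inr (.inl h)) hf)
    · exact .inl h
    · exact .inr (.inl h)
    · exact .inr (.inr (.inl h))
    · exact absurd hs (NilSpin.not_hasHarmonicSpinor_of_isomorphic Γ (.inr (.inr h)) hf)
    · exact .inr (.inr (.inr (.inl h)))
    · exact .inr (.inr (.inr (.inr h)))
  · rcases h with h | h | h | h | h
    · exact h.exists_harmonic W Γ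
    · exact h.exists_harmonic W Γ
    · exact h.exists_harmonic W Γ
    · exact h.exists_harmonic W Γ
    · exact h.exists_harmonic W Γ
  · obtain ⟨e, he, h⟩ := hlist.exists_isNormalForm g
    exact ⟨e, he, h.isNilpotentFrame, h⟩
  · intro e he f hf
    exact ⟨fun h => h.exists_diracSquareFormula Γ he hf, fun _ h => h.dirac Γ he hf,
      fun _ _ _ _ h => h.dirac Γ he hf, fun _ _ h => h.dirac Γ he hf,
      fun _ _ h => h.dirac Γ he hf, fun _ _ _ _ _ h => h.dirac Γ he hf,
      fun _ _ _ _ _ h => h.dirac Γ he hf, fun _ _ _ _ _ _ h => h.dirac Γ he hf,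
      fun _ _ _ _ _ _ _ h => h.dirac Γ he hf⟩
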